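/- Let $\alpha,\beta>0$ and let $L\ge1$ be an integer. Let $\mathcal V$ be the set of real sequences $(v(k))_{k\ge0}$ with $v(0)=1$, $v(k)\ge v(k+1)$ and $\lim_k v(k)=0$. Let $w=(w(k))_{k\ge1}$ be a sequence of positive reals such that, for some $c,d>0$, $c\,w(k+1)\le w(k)\le d\,w(k+1)$ for all $k\ge1$. Let $L_2(w)$ be the Hilbert space of real sequences $x$ with $x(0)=0$ and $\|x\|_{L_2(w)}^2=\sum_{k\ge1}x(k)^2/w(k)<\infty$. For $v\in\mathcal V$ write $v\in\mathcal V\cap L_2(w)$ if $\sum_{k\ge1}v(k)^2/w(k)<\infty$, and $v\in\mathcal V\cap\ell_1(w)$ if $\sum_{k\ge1}v(k)/w(k)<\infty$ (the coordinate $v(0)=1$ is disregarded). For $k\ge1$ let $$F_+(v)(k)=\alpha\bigl(v(k-1)^L-v(k)^L\bigr),\qquad F_-(v)(k)=\beta\bigl(v(k)-v(k+1)\bigr),$$ $$\mathbf K(v)x(k)=\alpha Lv(k-1)^{L-1}x(k-1)-\bigl(\alpha Lv(k)^{L-1}+\beta\bigr)x(k)+\beta x(k+1),$$ all three being $0$ for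 $k=0$. Let $u=(u_t)_{t\ge0}$ be a $\mathcal V$-valued solution, coordinate by coordinate, of $\dot u_t(k)=F_+(u_t)(k)-F_-(u_t)(k)$, $k\ge1$. Let $M=(M(k))_{k\ge0}$ be independent real continuous centered Gaussian martingales, null at time $0$, with brackets $\langle M(k)\rangle_t=\int_0^t\{F_+(u_s)(k)+F_-(u_s)(k)\}\,ds$. The Ornstein–Uhlenbeck (OU) SDE is $$Z_t=Z_0+\int_0^t\mathbf K(u_s)Z_s\,ds+M_t,\qquad t\ge0.\tag{1}$$ For $0\le s\le t$ let $U(t,s)=\mathrm e^{\int_s^t\mathbf K(u_r)\,dr}$ denote the time-ordered exponential $$U(t,s)=\sum_{n\ge0}\ \int_{s\le r_1\le\cdots\le r_n\le t}\mathbf K(u_{r_n})\cdots\mathbf K(u_{r_1})\,dr_1\cdots dr_n .$$ (a) For $v\in\mathcal V$ the operator $\mathbf K(v)$ is bounded on $L_2(w)$, and $\sup_{v\in\mathcal V}\|\mathbf K(v)\|<\infty$. (b) Let $u_0\in\mathcal V\cap L_2(w)$. Then for every $z_0\in L_2(w)$ the linear equation $\dot z_t=\mathbf K(u_t)z_t$,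 $t\ge0$, has a unique solution in $L_2(w)$ starting at $z_0$, namely $z_t=U(t,0)z_0$; and likewise, for every $s\ge0$, the unique solution on $[s,\infty)$ equal to $z_0$ at time $s$ is $U(t,s)z_0$. Moreover strong (pathwise) uniqueness holds for (1) in $L_2(w)$: two solutions on the same probability space, driven by the same $M$ and with a.s. equal initial values, are indistinguishable. (c) Let $u_0\in\mathcal V\cap\ell_1(w)$. Then $M$ is a square-integrable process in $L_2(w)$, and for every $L_2(w)$-valued random variable $Z_0$ equation (1) has a unique strong solution in $L_2(w)$ starting at $Z_0$ (with a.s. continuous paths and adapted to the completed filtration generated by $Z_0$ and $M$), given for each $t\ge0$ by $$Z_t=U(t,0)Z_0+\int_0^tU(t,s)\,dM_s\qquad\text{a.s.}$$ If $\mathbf E\bigl(\|Z_0\|_{L_2(w)}^2\bigr)<\infty$, then $\mathbf E\bigl(\sup_{t\le T}\|Z_t\|_{L_2(w)}^2\bigr)<\infty$ for every $T\ge0$. -/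

import Mathlib

open MeasureTheory ProbabilityTheory Filter Topology
open scoped NNReal ENNReal

noncomputable section

namespace OUQueue

/-! ### The sequence spaces -/

/-- The set `𝒱` of tails of probability measures on `ℕ`: non-increasing sequences with `v 0 = 1`
and limit `0`. -/
def tailSet : Set (ℕ → ℝ) :=
  {v | v 0 = 1 ∧ (∀ k, v (k + 1) ≤ v k) ∧ Tendsto v atTop (𝓝 0)}

/-- A weight: a sequence which is positive at every index `k ≥ 1` (the value at `0` is never
used). -/
structure Weight where
  val : ℕ → ℝ
  pos : ∀ k, 0 < val (k + 1)

/-- The weight is comparable with its shift: `c w(k+1) ≤ w(k) ≤ d w(k+1)` for all `k ≥ 1`. -/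
def Weight.Comparable (w : Weight) : Prop :=
  ∃ c d : ℝ, 0 < c ∧ 0 < d ∧
    ∀ k : ℕ, 1 ≤ k → c * w.val (k + 1) ≤ w.val k ∧ w.val k ≤ d * w.val (k + 1)

theorem summable_mul_div (w : Weight) {x y : ℕ → ℝ}
    (hx : Summable fun k => x (k + 1) ^ 2 / w.val (k + 1))
    (hy : Summable fun k => y (k + 1) ^ 2 / w.val (k + 1)) :
    Summable fun k => x (k + 1) * y (k + 1) / w.val (k + 1) := by
  refine Summable.of_norm_bounded (hx.add hy) fun k => ?_
  have hw := w.pos k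
  rw [Real.norm_eq_abs, abs_div, abs_of_pos hw, ← add_div]
  refine div_le_div_of_nonneg_right ?_ hw.le
  rw [abs_le]
  constructor <;> nlinarith [sq_nonneg (x (k + 1) + y (k + 1)), sq_nonneg (x (k + 1) - y (k + 1)),
    sq_nonneg (x (k + 1)), sq_nonneg (y (k + 1))]

/-- The real sequences `x` with `x 0 = 0` and `∑_{k ≥ 1} x(k)² / w(k) < ∞`, as a linear
subspace. -/
def L2sub (w : Weight) : Submodule ℝ (ℕ → ℝ) where
  carrier := {x | x 0 = 0 ∧ Summable fun k => x (k + 1) ^ 2 / w.val (k + 1)}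
  zero_mem' := by simp
  add_mem' := by
    rintro x y ⟨hx0, hx⟩ ⟨hy0, hy⟩
    refine ⟨by simp [hx0, hy0], ?_⟩
    refine ((hx.add ((summable_mul_div w hx hy).mul_left 2)).add hy).congr fun k => ?_
    simp only [Pi.add_apply]
    ring
  smul_mem' := by
    rintro a x ⟨hx0, hx⟩
    refine ⟨by simp [hx0], ?_⟩
    refine (hx.mul_left (a ^ 2)).congr fun k => ?_
    simp only [Pi.smul_apply, smul_eq_mul]
    ring

/-- The Hilbert space `L₂(w)`, with inner product `∑_{k ≥ 1} x(k) y(k) / w(k)`. (A type of its own,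
so that it does not carry the topology of pointwise convergence.) -/
def L2 (w : Weight) : Type := L2sub w

namespace L2

variable {w : Weight}

instance : AddCommGroup (L2 w) := inferInstanceAs (AddCommGroup (L2sub w))

instance : Module ℝ (L2 w) := inferInstanceAs (Module ℝ (L2sub w))

/-- The sequence underlying an element of `L₂(w)`. -/
def coord (x : L2 w) : ℕ → ℝ := Subtype.val (p := fun x => x ∈ L2sub w) x

instance : CoeFun (L2 w) (fun _ => ℕ → ℝ) := ⟨coord⟩

theorem ext {x y : L2 w} (h : ∀ k, x k = y k) : x = y := Subtype.ext (funext h)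

theorem apply_zero (x : L2 w) : x 0 = 0 := x.2.1

theorem summable_sq (x : L2 w) : Summable fun k => x (k + 1) ^ 2 / w.val (k + 1) := x.2.2

theorem add_apply (x y : L2 w) (k : ℕ) : (x + y) k = x k + y k := rfl

theorem smul_apply (a : ℝ) (x : L2 w) (k : ℕ) : (a • x) k = a * x k := rfl

theorem summable_mul (x y : L2 w) : Summable fun k => x (k + 1) * y (k + 1) / w.val (k + 1) :=
  summable_mul_div w x.summable_sq y.summable_sq

/-- The inner product `∑_{k ≥ 1} x(k) y(k) / w(k)`. -/
@[reducible] def core (w : Weight) : InnerProductSpace.Core ℝ (L2 w) where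
  inner x y := ∑' k, x (k + 1) * y (k + 1) / w.val (k + 1)
  conj_inner_symm x y := by
    simp only [conj_trivial]
    exact tsum_congr fun k => by ring
  re_inner_nonneg x := by
    refine tsum_nonneg fun k => ?_
    exact div_nonneg (mul_self_nonneg _) (w.pos k).le
  add_left x y z := by
    rw [← (summable_mul x z).tsum_add (summable_mul y z)]
    exact tsum_congr fun k => by rw [add_apply]; ring
  smul_left x y a := by
    simp only [conj_trivial]
    rw [← tsum_mul_left]
    exact tsum_congr fun k => by rw [smul_apply]; ring
  definite x hx := by
    have hn : ∀ k, 0 ≤ x (k + 1) * x (k + 1) / w.val (k + 1) :=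
      fun k => div_nonneg (mul_self_nonneg _) (w.pos k).le
    have h0 := (hasSum_zero_iff_of_nonneg hn).1 (hx ▸ (summable_mul x x).hasSum)
    refine ext fun k => ?_
    cases k with
    | zero => exact apply_zero x
    | succ k =>
      have h1 := congrFun h0 k
      have h2 : x (k + 1) = 0 := by simpa [(w.pos k).ne'] using h1
      exact h2

instance : NormedAddCommGroup (L2 w) := (core w).toNormedAddCommGroup

instance : InnerProductSpace ℝ (L2 w) := InnerProductSpace.ofCore (core w).toCore

instance : MeasurableSpace (L2 w) := borel _

instance : BorelSpace (L2 w) := ⟨rfl⟩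

theorem norm_sq_eq (x : L2 w) : ‖x‖ ^ 2 = ∑' k, x (k + 1) ^ 2 / w.val (k + 1) := by
  rw [← real_inner_self_eq_norm_sq]
  exact tsum_congr fun k => by rw [pow_two]

/-- `x ↦ (x(k+1) / √w(k+1))_{k ≥ 0}` is an isometry of `L₂(w)` onto `ℓ₂`. -/
def equivL2 (w : Weight) : L2 w ≃ₗᵢ[ℝ] lp (fun _ : ℕ => ℝ) 2 where
  toFun x := ⟨fun k => x (k + 1) / √(w.val (k + 1)), by
    refine memℓp_gen (x.summable_sq.congr fun k => ?_)
    simp [div_pow, Real.sq_sqrt (w.pos k).le]⟩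
  invFun y := ⟨fun k => Nat.casesOn k 0 (fun j => √(w.val (j + 1)) * y j), rfl, by
    have h := (memℓp_gen_iff (by norm_num)).1 y.2
    refine h.congr fun k => ?_
    have hw := (w.pos k).ne'
    simp only [mul_pow, Real.sq_sqrt (w.pos k).le]
    field_simp
    simp⟩
  left_inv x := by
    refine ext fun k => ?_
    cases k with
    | zero => exact (apply_zero x).symm
    | succ k =>
      change √(w.val (k + 1)) * (x (k + 1) / √(w.val (k + 1))) = x (k + 1)
      have := Real.sqrt_ne_zero'.2 (w.pos k)
      field_simp
  right_inv y := by
    refine lp.ext (funext fun k => ?_)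
    change √(w.val (k + 1)) * y k / √(w.val (k + 1)) = y k
    have := Real.sqrt_ne_zero'.2 (w.pos k)
    field_simp
  map_add' x y := by
    refine lp.ext (funext fun k => ?_)
    change (x + y) (k + 1) / √(w.val (k + 1)) = x (k + 1) / _ + y (k + 1) / _
    rw [add_apply, add_div]
  map_smul' a x := by
    refine lp.ext (funext fun k => ?_)
    change (a • x) (k + 1) / √(w.val (k + 1)) = a * (x (k + 1) / _)
    rw [smul_apply, mul_div_assoc]
  norm_map' x := by
    rw [← sq_eq_sq₀ (norm_nonneg _) (norm_nonneg _), norm_sq_eq, ← real_inner_self_eq_norm_sq,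
      lp.inner_eq_tsum]
    refine tsum_congr fun k => ?_
    have h := Real.sq_sqrt (w.pos k).le
    change x (k + 1) / √(w.val (k + 1)) * (x (k + 1) / √(w.val (k + 1))) = _
    rw [div_mul_div_comm, ← pow_two, ← pow_two, h]

instance : CompleteSpace (L2 w) :=
  ((equivL2 w).isometry.isUniformInducing.completeSpace_congr (equivL2 w).surjective).2
    inferInstance

end L2

/-! ### The nonlinear equation and its linearization -/

/-- `F₊(v)(k) = α (v(k-1)^L - v(k)^L)` for `k ≥ 1`, and `0` for `k = 0`. -/
def Fplus (α : ℝ) (L : ℕ) (v : ℕ → ℝ) : ℕ → ℝ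
  | 0 => 0
  | k + 1 => α * (v k ^ L - v (k + 1) ^ L)

/-- `F₋(v)(k) = β (v(k) - v(k+1))` for `k ≥ 1`, and `0` for `k = 0`. -/
def Fminus (β : ℝ) (v : ℕ → ℝ) : ℕ → ℝ
  | 0 => 0
  | k + 1 => β * (v (k + 1) - v (k + 2))

/-- `u` is a `𝒱`-valued solution of `u̇ = F(u)`, `F = F₊ - F₋`, on `[0, ∞)`. -/
def IsMeanFieldSolution (α β : ℝ) (L : ℕ) (u : ℝ → ℕ → ℝ) : Prop :=
  (∀ t, 0 ≤ t → u t ∈ tailSet) ∧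
    ∀ t, 0 ≤ t → ∀ k,
      HasDerivWithinAt (fun s => u s k) (Fplus α L (u t) k - Fminus β (u t) k) (Set.Ici 0) t

/-- The linearization
`(K(v)x)(k) = α L v(k-1)^(L-1) x(k-1) - (α L v(k)^(L-1) + β) x(k) + β x(k+1)` for `k ≥ 1`, with
value `0` at `k = 0`, on arbitrary sequences. -/
def linK (α β : ℝ) (L : ℕ) (v x : ℕ → ℝ) : ℕ → ℝ
  | 0 => 0
  | k + 1 => α * L * v k ^ (L - 1) * x k - (α * L * v (k + 1) ^ (L - 1) + β) * x (k + 1)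
      + β * x (k + 2)

open Classical in
/-- The bounded operator on `L₂(w)` which acts by the matrix of `K(v)`, whenever there is one
(it is then unique), and `0` otherwise. -/
def opK (α β : ℝ) (L : ℕ) (w : Weight) (v : ℕ → ℝ) : L2 w →L[ℝ] L2 w :=
  if h : ∃ T : L2 w →L[ℝ] L2 w, ∀ x k, T x k = linK α β L v x k then h.choose else 0

/-! ### Time-ordered exponentials -/

section Evolution

variable {E : Type*} [NormedAddCommGroup E] [NormedSpace ℝ E]

/-- The `n`-th term of the time-ordered exponential series,
`∫_{s ≤ r₁ ≤ ⋯ ≤ rₙ ≤ t} A(rₙ) ⋯ A(r₁) dr₁ ⋯ drₙ`. -/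
def orderedTerm (A : ℝ → E →L[ℝ] E) (s : ℝ) : ℕ → ℝ → E →L[ℝ] E
  | 0, _ => 1
  | n + 1, t => ∫ r in s..t, (A r).comp (orderedTerm A s n r)

/-- The time-ordered exponential of `∫_s^t A(r) dr`. -/
def timeOrderedExp (A : ℝ → E →L[ℝ] E) (t s : ℝ) : E →L[ℝ] E :=
  ∑' n, orderedTerm A s n t

/-- `z` is a solution of `ż = A(t) z` on `[s, ∞)`. -/
def IsLinearSolution (A : ℝ → E →L[ℝ] E) (s : ℝ) (z : ℝ → E) : Prop :=
  ∀ t, s ≤ t → HasDerivWithinAt z (A t (z t)) (Set.Ici s) t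

/-- `I` is the stochastic integral `∫_0^t Φ(s) dN_s` of a continuous deterministic operator-valued
integrand `Φ` with respect to the square-integrable process `N`: the limit in `L²(Ω; E)` of the
left-point Riemann sums over subdivisions `0 = τ 0 ≤ ⋯ ≤ τ n = t` of mesh tending to zero. -/
def IsStochIntegral {Ω : Type*} [MeasurableSpace Ω] (P : Measure Ω) (Φ : ℝ → E →L[ℝ] E)
    (N : ℝ≥0 → Ω → E) (t : ℝ≥0) (I : Ω → E) : Prop :=
  MemLp I 2 P ∧
    ∀ ε : ℝ≥0, 0 < ε → ∃ δ : ℝ≥0, 0 < δ ∧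
      ∀ (n : ℕ) (τ : ℕ → ℝ≥0), Monotone τ → τ 0 = 0 → τ n = t →
        (∀ i < n, τ (i + 1) ≤ τ i + δ) →
        eLpNorm (fun ω => (∑ i ∈ Finset.range n, Φ (τ i) (N (τ (i + 1)) ω - N (τ i) ω)) - I ω) 2 P
          ≤ ε

end Evolution

/-! ### The driving martingale and the Ornstein-Uhlenbeck equation -/

section Probability

variable {Ω : Type*} {mΩ : MeasurableSpace Ω}

/-- `M = (M(k))_k` is a sequence of independent continuous centered Gaussian martingales, null at
time `0`, with Doob-Meyer brackets `⟨M(k)⟩_t = ∫_0^t (F₊(u_s)(k) + F₋(u_s)(k)) ds`, that is,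
`M(k)² - ⟨M(k)⟩` is a martingale. -/
structure IsDrivingMartingale (α β : ℝ) (L : ℕ) (u : ℝ → ℕ → ℝ) (P : Measure Ω)
    (ℱ : Filtration ℝ≥0 mΩ) (M : ℕ → ℝ≥0 → Ω → ℝ) : Prop where
  indep : iIndepFun (fun k ω => fun t => M k t ω) P
  gaussian : ∀ k, IsGaussianProcess (M k) P
  centered : ∀ k t, ∫ ω, M k t ω ∂P = 0
  continuous_paths : ∀ᵐ ω ∂P, ∀ k, Continuous fun t => M k t ω
  start : ∀ k, M k 0 =ᵐ[P] 0
  martingale : ∀ k, Martingale (M k) ℱ P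
  bracket : ∀ k, Martingale
    (fun t ω => M k t ω ^ 2 - ∫ s in (0 : ℝ)..t, (Fplus α L (u s) k + Fminus β (u s) k)) ℱ P

/-- `Z` is an `L₂(w)`-valued solution of `Z_t = Z_0 + ∫_0^t K(u_s) Z_s ds + M_t`: almost surely, the
path of `Z` is Bochner integrable in `L₂(w)` on bounded intervals and the equation holds at
all times in each coordinate (so that `M_t` is then a.s. in `L₂(w)`, and `Z` is continuous as soon
as `M` is). -/
def IsOUSolution (α β : ℝ) (L : ℕ) (w : Weight) (u : ℝ → ℕ → ℝ) (P : Measure Ω)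
    (M : ℕ → ℝ≥0 → Ω → ℝ) (Z : ℝ≥0 → Ω → L2 w) : Prop :=
  ∀ᵐ ω ∂P,
    (∀ t : ℝ≥0, IntervalIntegrable (fun s : ℝ => Z s.toNNReal ω) volume 0 t) ∧
    ∀ (t : ℝ≥0) (k : ℕ),
      Z t ω k = Z 0 ω k
        + (∫ s in (0 : ℝ)..t, opK α β L w (u s) (Z s.toNNReal ω)) k + M k t ω

/-- The `σ`-field generated by `Z₀` and by `M_s(k)`, `s ≤ t`, `k ∈ ℕ`. -/
@[reducible] def drivingSigma {w : Weight} (Z₀ : Ω → L2 w) (M : ℕ → ℝ≥0 → Ω → ℝ) (t : ℝ≥0) :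
    MeasurableSpace Ω :=
  MeasurableSpace.comap Z₀ inferInstance ⊔
    ⨆ (k : ℕ) (s : ℝ≥0) (_ : s ≤ t), MeasurableSpace.comap (M k s) inferInstance

/-- `Z` is a strong solution starting at `Z₀`: a solution with a.s. continuous paths in `L₂(w)` which
is adapted to the filtration generated by `Z₀` and `M`, up to null sets. -/
structure IsStrongOUSolution (α β : ℝ) (L : ℕ) (w : Weight) (u : ℝ → ℕ → ℝ) (P : Measure Ω)
    (M : ℕ → ℝ≥0 → Ω → ℝ) (Z₀ : Ω → L2 w) (Z : ℝ≥0 → Ω → L2 w) : Prop where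
  start : Z 0 =ᵐ[P] Z₀
  adapted : ∀ t, AEStronglyMeasurable[drivingSigma Z₀ M t] (Z t) P
  continuous_paths : ∀ᵐ ω ∂P, Continuous fun t => Z t ω
  solution : IsOUSolution α β L w u P M Z

end Probability

end OUQueue

end

/-! The matrix of `K(v)` is tridiagonal with entries bounded uniformly over `tailSet`, and
comparability of `w` with its shift makes both shifts bounded on `L2 w`; hence the uniform bound
(`exists_tridiag`). The same estimate applied to `K(v) - K(v')` shows that the operator is Lipschitz
in the sup norm of `v`. Since all coordinates of `u` are Lipschitz in time with the one constant `α
+ β`, the family `K(u_r)` is norm-continuous and bounded (`continuous_pathK`). The linear equation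
is thus an ODE with bounded generator: the ordered series converges like an exponential, can be
differentiated termwise, and Grönwall gives uniqueness.

Strong uniqueness is pathwise: in the difference of two solutions the noise cancels, and what
remains solves the homogeneous integral equation (`eq_zero_of_eq_integral`).

For existence no Itô theory enters. The integrand `U(t,s)` is deterministic and differentiable in
`s` with derivative `-U(t,s)K(u_s)`, so integration by parts turns `∫ U(t,s) dM_s` into the pathwise
quantity `M_t + ∫ U(t,r) K(u_r) M_r dr`, called `duhamel`. It solves the equation path by path, and
the Riemann sums converge to it path by path (`norm_riemannSum_sub_duhamel_le`); domination by the
maximal function of `M` upgrades this to `L²`.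

Probability enters through Doob's `L²` inequality (`exists_lintegral_sup_sq_le`), used in each
coordinate and summed with weights `1/w`. The sum is finite because the brackets are bounded by `u`,
whose `ℓ₁(w)` norm stays locally bounded by Grönwall (`IsMeanFieldSolution.sum_le`). The summed
majorant also gives continuity of `M` in `L2 w`, by dominated convergence. -/

namespace OUQueue

/-! ### Time-ordered exponentials of bounded, norm-continuous operator families. -/

section Evolution

variable {E : Type*} [NormedAddCommGroup E] [NormedSpace ℝ E]

theorem continuous_orderedTerm {A : ℝ → E →L[ℝ] E} (hA : Continuous A) (s : ℝ) (n : ℕ) :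
    Continuous (orderedTerm A s n) := by
  induction n with
  | zero => exact continuous_const
  | succ n ih =>
    exact intervalIntegral.continuous_primitive
      (fun a b => (hA.clm_comp ih).intervalIntegrable a b) s

theorem orderedTerm_succ_self (A : ℝ → E →L[ℝ] E) (s : ℝ) (n : ℕ) :
    orderedTerm A s (n + 1) s = 0 := intervalIntegral.integral_same

theorem timeOrderedExp_self (A : ℝ → E →L[ℝ] E) (s : ℝ) : timeOrderedExp A s s = 1 := by
  rw [timeOrderedExp, tsum_eq_single 0]
  · rfl
  · intro n hn
    obtain ⟨m, rfl⟩ := Nat.exists_eq_succ_of_ne_zero hn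
    exact orderedTerm_succ_self A s m

theorem orderedTerm_congr {A B : ℝ → E →L[ℝ] E} {s T : ℝ} (h : ∀ r, s ≤ r → r ≤ T → A r = B r)
    (n : ℕ) {t : ℝ} (hst : s ≤ t) (ht : t ≤ T) : orderedTerm A s n t = orderedTerm B s n t := by
  induction n generalizing t with
  | zero => rfl
  | succ n ih =>
    refine intervalIntegral.integral_congr fun r hr => ?_
    rw [Set.uIcc_of_le hst] at hr
    rw [ih hr.1 (hr.2.trans ht), h r hr.1 (hr.2.trans ht)]

theorem timeOrderedExp_congr {A B : ℝ → E →L[ℝ] E} {s t : ℝ} (hst : s ≤ t)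
    (h : ∀ r, s ≤ r → r ≤ t → A r = B r) : timeOrderedExp A t s = timeOrderedExp B t s :=
  tsum_congr fun n => orderedTerm_congr h n hst le_rfl

/-- The simplex of ordered times has volume `|t - s|^n / n!`. The absolute value covers `t < s`:
backward evolutions serve as inverses later. -/
theorem norm_orderedTerm_le {A : ℝ → E →L[ℝ] E} (hA : Continuous A) {C : ℝ}
    (hC : ∀ r, ‖A r‖ ≤ C) (s : ℝ) (n : ℕ) (t : ℝ) :
    ‖orderedTerm A s n t‖ ≤ (C * |t - s|) ^ n / n.factorial := by
  have hC0 : 0 ≤ C := (norm_nonneg _).trans (hC 0)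
  induction n generalizing t with
  | zero =>
    rw [pow_zero, Nat.factorial_zero, Nat.cast_one, div_one]
    exact ContinuousLinearMap.norm_id_le
  | succ n ih =>
    have hc := hA.clm_comp (continuous_orderedTerm hA s n)
    calc ‖orderedTerm A s (n + 1) t‖
        ≤ ∫ r in Set.uIoc s t, ‖(A r).comp (orderedTerm A s n r)‖ :=
          intervalIntegral.norm_integral_le_integral_norm_uIoc
      _ ≤ ∫ r in Set.uIoc s t, C ^ (n + 1) / n.factorial * |r - s| ^ n := by
          refine setIntegral_mono ?_ ?_ fun r => ?_
          · exact (hc.norm.integrableOn_uIcc).mono_set Set.uIoc_subset_uIcc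
          · exact (Continuous.integrableOn_uIcc (by fun_prop)).mono_set Set.uIoc_subset_uIcc
          · refine (ContinuousLinearMap.opNorm_comp_le _ _).trans ?_
            refine (mul_le_mul (hC r) (ih r) (norm_nonneg _) hC0).trans (le_of_eq ?_)
            rw [mul_pow]; ring
      _ = (C * |t - s|) ^ (n + 1) / (n + 1).factorial := by
          rw [integral_const_mul, integral_pow_abs_sub_uIoc, mul_pow, Nat.factorial_succ]
          push_cast
          field_simp

variable [CompleteSpace E]

theorem hasDerivAt_orderedTerm_succ {A : ℝ → E →L[ℝ] E} (hA : Continuous A) (s : ℝ) (n : ℕ)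
    (t : ℝ) :
    HasDerivAt (orderedTerm A s (n + 1)) ((A t).comp (orderedTerm A s n t)) t := by
  have hc := hA.clm_comp (continuous_orderedTerm hA s n)
  exact intervalIntegral.integral_hasDerivAt_right (hc.intervalIntegrable _ _)
    (hc.stronglyMeasurableAtFilter _ _) hc.continuousAt

theorem summable_orderedTerm {A : ℝ → E →L[ℝ] E} (hA : Continuous A) {C : ℝ}
    (hC : ∀ r, ‖A r‖ ≤ C) (s t : ℝ) : Summable fun n => orderedTerm A s n t :=
  Summable.of_norm_bounded (Real.summable_pow_div_factorial _) fun n =>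
    norm_orderedTerm_le hA hC s n t

theorem hasDerivAt_timeOrderedExp {A : ℝ → E →L[ℝ] E} (hA : Continuous A) {C : ℝ}
    (hC : ∀ r, ‖A r‖ ≤ C) (s t : ℝ) :
    HasDerivAt (fun t => timeOrderedExp A t s) (A t * timeOrderedExp A t s) t := by
  rw [ContinuousLinearMap.mul_def]
  have hC0 : 0 ≤ C := (norm_nonneg _).trans (hC 0)
  -- Termwise differentiation needs bounds uniform on an open connected set; this ball contains `t`.
  -- The constant term `n = 0` is split off, since term `n + 1` differentiates to `A` times term
  -- `n`.
  set R := |t - s| + 1 with hR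
  have hsum : ∀ r, timeOrderedExp A r s = 1 + ∑' n, orderedTerm A s (n + 1) r := fun r => by
    rw [timeOrderedExp, (summable_orderedTerm hA hC s r).tsum_eq_zero_add]
    rfl
  have hball : ∀ y ∈ Metric.ball s R, |y - s| ≤ R := fun y hy => (Metric.mem_ball.1 hy).le
  have hmem : t ∈ Metric.ball s R := by
    rw [Metric.mem_ball, Real.dist_eq]; linarith
  have hu : Summable fun n : ℕ => C * ((C * R) ^ n / n.factorial) :=
    (Real.summable_pow_div_factorial _).mul_left C
  have hd : ∀ (n : ℕ) (y : ℝ), y ∈ Metric.ball s R →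
      HasDerivAt (orderedTerm A s (n + 1)) ((A y).comp (orderedTerm A s n y)) y :=
    fun n y _ => hasDerivAt_orderedTerm_succ hA s n y
  have hb : ∀ (n : ℕ) (y : ℝ), y ∈ Metric.ball s R →
      ‖(A y).comp (orderedTerm A s n y)‖ ≤ C * ((C * R) ^ n / n.factorial) := by
    intro n y hy
    refine (ContinuousLinearMap.opNorm_comp_le _ _).trans ?_
    refine mul_le_mul (hC y) ((norm_orderedTerm_le hA hC s n y).trans ?_) (norm_nonneg _) hC0
    gcongr
    exact hball y hy
  have hs : Summable fun n => orderedTerm A s (n + 1) t :=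
    (summable_nat_add_iff 1).2 (summable_orderedTerm hA hC s t)
  have key := hasDerivAt_tsum_of_isPreconnected hu Metric.isOpen_ball
    (convex_ball s R).isPreconnected hd hb hmem hs hmem
  have h2 : ∑' n, (A t).comp (orderedTerm A s n t) = (A t).comp (timeOrderedExp A t s) :=
    (((ContinuousLinearMap.compL ℝ E E E (A t)).hasSum
      (summable_orderedTerm hA hC s t).hasSum).tsum_eq)
  rw [h2] at key
  rw [funext hsum]
  exact key.const_add 1

/-- As functions of `t`, both sides solve `X' = A X` and agree at `t = r`. -/
theorem timeOrderedExp_comp {A : ℝ → E →L[ℝ] E} (hA : Continuous A) {C : ℝ}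
    (hC : ∀ r, ‖A r‖ ≤ C) (t r s : ℝ) :
    timeOrderedExp A t r * timeOrderedExp A r s = timeOrderedExp A t s := by
  have hv : ∀ t : ℝ, LipschitzOnWith C.toNNReal (fun X : E →L[ℝ] E => A t * X) Set.univ := by
    refine fun t => LipschitzWith.lipschitzOnWith (LipschitzWith.of_dist_le' fun X Y => ?_)
    rw [dist_eq_norm, dist_eq_norm, ← mul_sub]
    exact (norm_mul_le _ _).trans (mul_le_mul_of_nonneg_right (hC t) (norm_nonneg _))
  have hf : ∀ t, HasDerivAt (fun t => timeOrderedExp A t r * timeOrderedExp A r s)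
      (A t * (timeOrderedExp A t r * timeOrderedExp A r s)) t := fun t => by
    rw [← mul_assoc]
    exact (hasDerivAt_timeOrderedExp hA hC r t).mul_const (timeOrderedExp A r s)
  have h0 : timeOrderedExp A r r * timeOrderedExp A r s = timeOrderedExp A r s := by
    rw [timeOrderedExp_self, one_mul]
  have h := ODE_solution_unique_univ hv (fun t => ⟨hf t, trivial⟩)
    (fun t => ⟨hasDerivAt_timeOrderedExp hA hC s t, trivial⟩) h0
  exact congrFun h t

omit [CompleteSpace E] in
theorem norm_timeOrderedExp_le {A : ℝ → E →L[ℝ] E} (hA : Continuous A) {C : ℝ}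
    (hC : ∀ r, ‖A r‖ ≤ C) (t s : ℝ) : ‖timeOrderedExp A t s‖ ≤ Real.exp (C * |t - s|) := by
  rw [Real.exp_eq_exp_ℝ, NormedSpace.exp_eq_tsum_div]
  exact tsum_of_norm_bounded (Real.summable_pow_div_factorial _).hasSum
    fun n => norm_orderedTerm_le hA hC s n t

/-- `U(t,s)` is the inverse of `U(s,t)`, so the derivative of inversion in the operator algebra
reduces the second variable to the first. -/
theorem hasDerivAt_timeOrderedExp_right {A : ℝ → E →L[ℝ] E} (hA : Continuous A) {C : ℝ}
    (hC : ∀ r, ‖A r‖ ≤ C) (t s : ℝ) :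
    HasDerivAt (fun s => timeOrderedExp A t s) (-(timeOrderedExp A t s * A s)) s := by
  have hinv : ∀ a b, timeOrderedExp A a b * timeOrderedExp A b a = 1 := fun a b => by
    rw [timeOrderedExp_comp hA hC, timeOrderedExp_self]
  let x : ℝ → (E →L[ℝ] E)ˣ := fun r =>
    ⟨timeOrderedExp A r t, timeOrderedExp A t r, hinv _ _, hinv _ _⟩
  have h := (hasFDerivAt_ringInverse (𝕜 := ℝ) (x s)).comp_hasDerivAt s
    (hasDerivAt_timeOrderedExp hA hC t s)
  have he : Ring.inverse ∘ (fun r => timeOrderedExp A r t) = fun r => timeOrderedExp A t r :=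
    funext fun r => Ring.inverse_unit (x r)
  rw [he] at h
  refine h.congr_deriv ?_
  change -(timeOrderedExp A t s * (A s * timeOrderedExp A s t) * timeOrderedExp A t s) = _
  rw [mul_assoc, mul_assoc, hinv, mul_one]

theorem continuous_timeOrderedExp_right {A : ℝ → E →L[ℝ] E} (hA : Continuous A) {C : ℝ}
    (hC : ∀ r, ‖A r‖ ≤ C) (t : ℝ) : Continuous fun s => timeOrderedExp A t s :=
  continuous_iff_continuousAt.2 fun s => (hasDerivAt_timeOrderedExp_right hA hC t s).continuousAt

omit [CompleteSpace E] in
theorem IsLinearSolution.unique {A : ℝ → E →L[ℝ] E} {C : ℝ} {s : ℝ} (hC : ∀ r, s ≤ r → ‖A r‖ ≤ C)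
    {y z : ℝ → E} (hy : IsLinearSolution A s y) (hz : IsLinearSolution A s z) (h : y s = z s)
    {t : ℝ} (ht : s ≤ t) : y t = z t := by
  have hC0 : 0 ≤ C := (norm_nonneg _).trans (hC s le_rfl)
  refine ODE_solution_unique_of_mem_Icc_right (v := fun t x => A t x) (K := ⟨C, hC0⟩)
    (s := fun _ => Set.univ) (a := s) (b := t) (fun r hr => ?_)
    (fun r hr => ((hy r hr.1).continuousWithinAt.mono fun x hx => hx.1))
    (fun r hr => (hy r hr.1).mono (Set.Ici_subset_Ici.2 hr.1)) (fun _ _ => trivial)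
    (fun r hr => ((hz r hr.1).continuousWithinAt.mono fun x hx => hx.1))
    (fun r hr => (hz r hr.1).mono (Set.Ici_subset_Ici.2 hr.1)) (fun _ _ => trivial)
    h ⟨ht, le_rfl⟩
  refine LipschitzWith.lipschitzOnWith (LipschitzWith.of_dist_le_mul fun X Y => ?_)
  rw [dist_eq_norm, dist_eq_norm, ← map_sub]
  exact (A r).le_of_opNorm_le (hC r hr.1) _

end Evolution

end OUQueue

namespace OUQueue

/-! ### Pathwise variation of constants for a continuous forcing. -/

section Duhamel

variable {E : Type*} [NormedAddCommGroup E] [NormedSpace ℝ E] [CompleteSpace E]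

theorem isLinearSolution_timeOrderedExp {A : ℝ → E →L[ℝ] E} (hA : Continuous A) {C : ℝ}
    (hC : ∀ r, ‖A r‖ ≤ C) (s : ℝ) (z₀ : E) :
    IsLinearSolution A s (fun t => timeOrderedExp A t s z₀) := by
  intro t _
  have h := (hasDerivAt_timeOrderedExp hA hC s t).clm_apply (hasDerivAt_const t z₀)
  rw [map_zero, add_zero] at h
  exact h.hasDerivWithinAt

/-- The process `m_t + ∫_0^t U(t,r) A(r) m_r dr`, which is `∫_0^t U(t,r) dm_r` integrated by
parts. -/
noncomputable def duhamel (A : ℝ → E →L[ℝ] E) (m : ℝ → E) (t : ℝ) : E :=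
  m t + timeOrderedExp A t 0 (∫ r in (0 : ℝ)..t, timeOrderedExp A 0 r (A r (m r)))

theorem continuous_timeOrderedExp_right_apply {A : ℝ → E →L[ℝ] E} (hA : Continuous A) {C : ℝ}
    (hC : ∀ r, ‖A r‖ ≤ C) {m : ℝ → E} (hm : Continuous m) (t : ℝ) :
    Continuous fun r => timeOrderedExp A t r (A r (m r)) :=
  (continuous_timeOrderedExp_right hA hC t).clm_apply (hA.clm_apply hm)

/-- The definition keeps `t` out of the integrand and suits differentiation; this form suits
estimates. -/
theorem duhamel_eq {A : ℝ → E →L[ℝ] E} (hA : Continuous A) {C : ℝ}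
    (hC : ∀ r, ‖A r‖ ≤ C) {m : ℝ → E} (hm : Continuous m) (t : ℝ) :
    duhamel A m t = m t + ∫ r in (0 : ℝ)..t, timeOrderedExp A t r (A r (m r)) := by
  have hi := (continuous_timeOrderedExp_right_apply hA hC hm 0).intervalIntegrable (μ := volume) 0 t
  rw [duhamel, ← ContinuousLinearMap.intervalIntegral_comp_comm _ hi]
  congr 1
  refine intervalIntegral.integral_congr fun r _ => ?_
  change timeOrderedExp A t 0 (timeOrderedExp A 0 r (A r (m r))) = _
  rw [← timeOrderedExp_comp hA hC t 0 r]
  rfl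

/-- The forcing `m` is merely continuous; subtracting it leaves a differentiable function, whose
derivative is `A` applied to the unsubtracted path. -/
theorem hasDerivAt_mild {A : ℝ → E →L[ℝ] E} (hA : Continuous A) {C : ℝ}
    (hC : ∀ r, ‖A r‖ ≤ C) {m : ℝ → E} (hm : Continuous m) (z₀ : E) (t : ℝ) :
    HasDerivAt (fun t => timeOrderedExp A t 0 z₀ + duhamel A m t - m t)
      (A t (timeOrderedExp A t 0 z₀ + duhamel A m t)) t := by
  have hg := continuous_timeOrderedExp_right_apply hA hC hm 0
  have hU := hasDerivAt_timeOrderedExp hA hC 0 t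
  have hJ : HasDerivAt (fun t => ∫ r in (0 : ℝ)..t, timeOrderedExp A 0 r (A r (m r)))
      (timeOrderedExp A 0 t (A t (m t))) t :=
    intervalIntegral.integral_hasDerivAt_right (hg.intervalIntegrable _ _)
      (hg.stronglyMeasurableAtFilter _ _) hg.continuousAt
  have h1 := hU.clm_apply (hasDerivAt_const t z₀)
  have h := h1.add (hU.clm_apply hJ)
  have hinv : timeOrderedExp A t 0 (timeOrderedExp A 0 t (A t (m t))) = A t (m t) := by
    rw [← mul_apply_eq_comp, timeOrderedExp_comp hA hC, timeOrderedExp_self]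
    rfl
  have he : (fun t => timeOrderedExp A t 0 z₀ + duhamel A m t - m t) =
      (fun t => timeOrderedExp A t 0 z₀) + fun t => timeOrderedExp A t 0
        (∫ r in (0 : ℝ)..t, timeOrderedExp A 0 r (A r (m r))) := by
    funext r
    simp only [duhamel, Pi.add_apply]
    abel
  rw [he]
  refine h.congr_deriv ?_
  rw [hinv, map_zero, add_zero, duhamel, map_add, map_add, mul_apply_eq_comp,
    mul_apply_eq_comp]
  abel

theorem continuous_mild {A : ℝ → E →L[ℝ] E} (hA : Continuous A) {C : ℝ}
    (hC : ∀ r, ‖A r‖ ≤ C) {m : ℝ → E} (hm : Continuous m) (z₀ : E) :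
    Continuous fun t => timeOrderedExp A t 0 z₀ + duhamel A m t := by
  have h : Continuous fun t => timeOrderedExp A t 0 z₀ + duhamel A m t - m t :=
    continuous_iff_continuousAt.2 fun t => (hasDerivAt_mild hA hC hm z₀ t).continuousAt
  exact (h.add hm).congr fun t => sub_add_cancel _ _

theorem mild_integral_eq {A : ℝ → E →L[ℝ] E} (hA : Continuous A) {C : ℝ}
    (hC : ∀ r, ‖A r‖ ≤ C) {m : ℝ → E} (hm : Continuous m) (z₀ : E) (t : ℝ) :
    timeOrderedExp A t 0 z₀ + duhamel A m t =
      z₀ + (∫ r in (0 : ℝ)..t, A r (timeOrderedExp A r 0 z₀ + duhamel A m r)) + m t := by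
  rw [intervalIntegral.integral_eq_sub_of_hasDerivAt
    (fun r _ => hasDerivAt_mild hA hC hm z₀ r)
    ((hA.clm_apply (continuous_mild hA hC hm z₀)).intervalIntegrable _ _)]
  simp only [duhamel, timeOrderedExp_self, intervalIntegral.integral_same, map_zero,
    one_apply_eq_self]
  abel

omit [CompleteSpace E] in
theorem norm_timeOrderedExp_apply_le {A : ℝ → E →L[ℝ] E} (hA : Continuous A) {C : ℝ}
    (hC : ∀ r, ‖A r‖ ≤ C) {r t : ℝ} (h0 : 0 ≤ r) (ht : r ≤ t) {x : E} {G : ℝ} (hx : ‖x‖ ≤ G) :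
    ‖timeOrderedExp A t r (A r x)‖ ≤ Real.exp (C * t) * C * G := by
  have hC0 : 0 ≤ C := (norm_nonneg _).trans (hC 0)
  have h1 : ‖timeOrderedExp A t r‖ ≤ Real.exp (C * t) := by
    refine (norm_timeOrderedExp_le hA hC t r).trans (Real.exp_le_exp.2 ?_)
    rw [abs_of_nonneg (by linarith)]
    gcongr
    linarith
  refine (ContinuousLinearMap.le_of_opNorm_le_of_le _ h1
    (ContinuousLinearMap.le_of_opNorm_le_of_le _ (hC r) hx)).trans (le_of_eq (by ring))

theorem norm_duhamel_le {A : ℝ → E →L[ℝ] E} (hA : Continuous A) {C : ℝ}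
    (hC : ∀ r, ‖A r‖ ≤ C) {m : ℝ → E} (hm : Continuous m) {t G : ℝ} (ht : 0 ≤ t)
    (hG : ∀ r, 0 ≤ r → r ≤ t → ‖m r‖ ≤ G) :
    ‖duhamel A m t‖ ≤ (1 + Real.exp (C * t) * C * t) * G := by
  rw [duhamel_eq hA hC hm]
  refine (norm_add_le _ _).trans ?_
  have h := intervalIntegral.norm_integral_le_of_norm_le_const (a := 0) (b := t)
    (f := fun r => timeOrderedExp A t r (A r (m r))) (C := Real.exp (C * t) * C * G)
    fun r hr => by
      rw [Set.uIoc_of_le ht] at hr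
      exact norm_timeOrderedExp_apply_le hA hC hr.1.le hr.2 (hG r hr.1.le hr.2)
  rw [sub_zero, abs_of_nonneg ht] at h
  have := hG t ht le_rfl
  linarith

/-- Summation by parts makes the Riemann sum equal to `duhamel` with `m r` frozen at the right
endpoint of each cell, so the error is controlled by the oscillation `η` of `m` over the cells. -/
theorem norm_riemannSum_sub_duhamel_le {A : ℝ → E →L[ℝ] E} (hA : Continuous A) {C : ℝ}
    (hC : ∀ r, ‖A r‖ ≤ C) {m : ℝ → E} (hm : Continuous m) (hm0 : m 0 = 0) {t η : ℝ} {n : ℕ}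
    {τ : ℕ → ℝ} (hτ : Monotone τ) (hτ0 : τ 0 = 0) (hτn : τ n = t)
    (hη : ∀ i < n, ∀ r, τ i ≤ r → r ≤ τ (i + 1) → ‖m (τ (i + 1)) - m r‖ ≤ η) :
    ‖(∑ i ∈ Finset.range n, timeOrderedExp A t (τ i) (m (τ (i + 1)) - m (τ i))) - duhamel A m t‖
      ≤ Real.exp (C * t) * C * t * η := by
  have hg := continuous_timeOrderedExp_right_apply hA hC hm t
  have hB : Continuous fun r => timeOrderedExp A t r * A r :=
    (continuous_timeOrderedExp_right hA hC t).mul hA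
  -- Discrete integration by parts, with `U(t,τ i) - U(t,τ (i+1)) = ∫ U(t,r) A(r) dr` over the cell.
  have hstep : ∀ i, timeOrderedExp A t (τ i) (m (τ (i + 1)) - m (τ i)) =
      (timeOrderedExp A t (τ (i + 1)) (m (τ (i + 1))) - timeOrderedExp A t (τ i) (m (τ i)))
        + ∫ r in (τ i)..(τ (i + 1)), timeOrderedExp A t r (A r (m (τ (i + 1)))) := by
    intro i
    have h1 := intervalIntegral.integral_eq_sub_of_hasDerivAt
      (fun r (_ : r ∈ Set.uIcc (τ i) (τ (i + 1))) =>
        (hasDerivAt_timeOrderedExp_right hA hC t r))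
      (hB.neg.intervalIntegrable _ _)
    have h2 : ∫ r in (τ i)..(τ (i + 1)), timeOrderedExp A t r (A r (m (τ (i + 1)))) =
        (∫ r in (τ i)..(τ (i + 1)), timeOrderedExp A t r * A r) (m (τ (i + 1))) :=
      (ContinuousLinearMap.intervalIntegral_apply (hB.intervalIntegrable _ _) _).symm
    rw [intervalIntegral.integral_neg, neg_eq_iff_eq_neg] at h1
    rw [h2, h1, map_sub, neg_sub, sub_apply]
    abel
  -- The boundary terms reduce to `m t`, because `U(t,t) = 1` and `m 0 = 0`.
  have hsum : duhamel A m t = timeOrderedExp A t (τ n) (m (τ n)) -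
      timeOrderedExp A t (τ 0) (m (τ 0)) +
      ∑ i ∈ Finset.range n, ∫ r in (τ i)..(τ (i + 1)), timeOrderedExp A t r (A r (m r)) := by
    rw [intervalIntegral.sum_integral_adjacent_intervals
      (fun k _ => hg.intervalIntegrable _ _), hτ0, hτn, hm0, timeOrderedExp_self, map_zero, sub_zero,
      duhamel_eq hA hC hm]
    rfl
  rw [Finset.sum_congr rfl fun i _ => hstep i, Finset.sum_add_distrib,
    Finset.sum_range_sub fun i => timeOrderedExp A t (τ i) (m (τ i)), hsum, add_sub_add_left_eq_sub,
    ← Finset.sum_sub_distrib]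
  have hle : ∀ i ∈ Finset.range n,
      ‖(∫ r in (τ i)..(τ (i + 1)), timeOrderedExp A t r (A r (m (τ (i + 1))))) -
        ∫ r in (τ i)..(τ (i + 1)), timeOrderedExp A t r (A r (m r))‖ ≤
      Real.exp (C * t) * C * η * (τ (i + 1) - τ i) := by
    intro i hi
    have hi' := Finset.mem_range.1 hi
    have hii : τ i ≤ τ (i + 1) := hτ (Nat.le_succ i)
    have h0i : 0 ≤ τ i := hτ0 ▸ hτ (Nat.zero_le i)
    have hit : τ (i + 1) ≤ t := hτn ▸ hτ hi'
    rw [← intervalIntegral.integral_sub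
      (Continuous.intervalIntegrable
        (continuous_timeOrderedExp_right_apply hA hC continuous_const t) _ _)
      (hg.intervalIntegrable _ _)]
    refine (intervalIntegral.norm_integral_le_of_norm_le_const
      (C := Real.exp (C * t) * C * η) fun r hr => ?_).trans
      (le_of_eq (by rw [abs_of_nonneg (by linarith)]))
    rw [Set.uIoc_of_le hii] at hr
    rw [← map_sub, ← map_sub]
    exact norm_timeOrderedExp_apply_le hA hC (h0i.trans hr.1.le) (hr.2.trans hit)
      (hη i hi' r hr.1.le hr.2)
  refine (norm_sum_le_of_le _ hle).trans (le_of_eq ?_)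
  rw [← Finset.mul_sum, Finset.sum_range_sub, hτn, hτ0]
  ring

end Duhamel

end OUQueue

/-! ### Tridiagonal operators on `L₂(w)`: boundedness and Lipschitz dependence of `K(v)`. -/

namespace OUQueue

/-- The action of the tridiagonal matrix with diagonals `a`, `b`, `c` on sequences. -/
def tridiag (a b c x : ℕ → ℝ) : ℕ → ℝ
  | 0 => 0
  | k + 1 => a k * x k + b k * x (k + 1) + c k * x (k + 2)

/-- The term `y 0 / w 1` is kept apart because comparability says nothing about `w.val 0`. -/
theorem summable_shift_right {w : Weight} {d : ℝ}
    (hd : ∀ k : ℕ, 1 ≤ k → w.val k ≤ d * w.val (k + 1)) {y : ℕ → ℝ} (hy : ∀ k, 0 ≤ y k)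
    (hs : Summable fun k => y (k + 1) / w.val (k + 1)) :
    (Summable fun k => y k / w.val (k + 1)) ∧
      ∑' k, y k / w.val (k + 1) ≤ y 0 / w.val 1 + d * ∑' k, y (k + 1) / w.val (k + 1) := by
  have hle : ∀ k, y (k + 1) / w.val (k + 2) ≤ d * (y (k + 1) / w.val (k + 1)) := fun k => by
    have h1 := w.pos k
    have h2 := w.pos (k + 1)
    rw [← mul_div_assoc, div_le_div_iff₀ h2 h1]
    nlinarith [mul_le_mul_of_nonneg_left (hd (k + 1) (by omega)) (hy (k + 1))]
  have hs' : Summable fun k => y (k + 1) / w.val (k + 2) :=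
    Summable.of_nonneg_of_le (fun k => div_nonneg (hy _) (w.pos _).le) hle (hs.mul_left d)
  have hs'' : Summable fun k => y k / w.val (k + 1) := (summable_nat_add_iff 1).1 hs'
  refine ⟨hs'', ?_⟩
  rw [hs''.tsum_eq_zero_add, ← tsum_mul_left]
  exact add_le_add_right (hs'.tsum_le_tsum hle (hs.mul_left d)) _

theorem summable_shift_left {w : Weight} {c : ℝ} (hc0 : 0 < c)
    (hc : ∀ k : ℕ, 1 ≤ k → c * w.val (k + 1) ≤ w.val k) {y : ℕ → ℝ} (hy : ∀ k, 0 ≤ y k)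
    (hs : Summable fun k => y (k + 1) / w.val (k + 1)) :
    (Summable fun k => y (k + 2) / w.val (k + 1)) ∧
      ∑' k, y (k + 2) / w.val (k + 1) ≤ c⁻¹ * ∑' k, y (k + 1) / w.val (k + 1) := by
  have hle : ∀ k, y (k + 2) / w.val (k + 1) ≤ c⁻¹ * (y (k + 2) / w.val (k + 2)) := fun k => by
    have h1 := w.pos k
    have h2 := w.pos (k + 1)
    rw [← mul_div_assoc, inv_mul_eq_div, div_div, div_le_div_iff₀ h1 (by positivity)]
    exact mul_le_mul_of_nonneg_left (hc (k + 1) (by omega)) (hy _)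
  have ht : Summable fun k => y (k + 2) / w.val (k + 2) := (summable_nat_add_iff 1).2 hs
  have hs' : Summable fun k => y (k + 2) / w.val (k + 1) :=
    Summable.of_nonneg_of_le (fun k => div_nonneg (hy _) (w.pos _).le) hle (ht.mul_left _)
  refine ⟨hs', (hs'.tsum_le_tsum hle (ht.mul_left _)).trans ?_⟩
  rw [tsum_mul_left, hs.tsum_eq_zero_add]
  have : 0 ≤ y (0 + 1) / w.val (0 + 1) := div_nonneg (hy _) (w.pos _).le
  exact mul_le_mul_of_nonneg_left (le_add_of_nonneg_left this) (inv_nonneg.2 hc0.le)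

/-- `C` depends on the weight only and the bound is linear in `B`, so one lemma yields both the
uniform bound and the Lipschitz estimate. -/
theorem exists_tridiag {w : Weight} (hw : w.Comparable) :
    ∃ C : ℝ, 0 ≤ C ∧ ∀ (B : ℝ) (a b c : ℕ → ℝ), (∀ k, |a k| ≤ B) → (∀ k, |b k| ≤ B) →
      (∀ k, |c k| ≤ B) → ∃ T : L2 w →L[ℝ] L2 w, (∀ x k, T x k = tridiag a b c x k) ∧
        ‖T‖ ≤ C * B := by
  obtain ⟨c₀, d₀, hc₀, hd₀, hcd⟩ := hw
  -- The 3 comes from `(p + q + r)² ≤ 3(p² + q² + r²)`; the summands `d₀`, `1`, `c₀⁻¹` come from the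
  -- right shift, the diagonal and the left shift.
  refine ⟨√(3 * (d₀ + 1 + c₀⁻¹)), Real.sqrt_nonneg _, fun B a b c ha hb hc => ?_⟩
  have hB : 0 ≤ B := (abs_nonneg _).trans (ha 0)
  have hsq : ∀ {p y : ℝ}, |p| ≤ B → (p * y) ^ 2 ≤ B ^ 2 * y ^ 2 := fun {p y} h => by
    rw [mul_pow]
    exact mul_le_mul_of_nonneg_right (sq_le_sq' (abs_le.1 h).1 (abs_le.1 h).2) (sq_nonneg _)
  have hle : ∀ (x : L2 w) (k : ℕ), tridiag a b c x (k + 1) ^ 2 / w.val (k + 1) ≤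
      3 * B ^ 2 * (x k ^ 2 / w.val (k + 1) + x (k + 1) ^ 2 / w.val (k + 1)
        + x (k + 2) ^ 2 / w.val (k + 1)) := fun x k => by
    rw [← add_div, ← add_div, ← mul_div_assoc]
    refine div_le_div_of_nonneg_right ?_ (w.pos k).le
    have h1 := hsq (y := x k) (ha k)
    have h2 := hsq (y := x (k + 1)) (hb k)
    have h3 := hsq (y := x (k + 2)) (hc k)
    rw [tridiag]
    nlinarith [sq_nonneg (a k * x k - b k * x (k + 1)), sq_nonneg (a k * x k - c k * x (k + 2)),
      sq_nonneg (b k * x (k + 1) - c k * x (k + 2))]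
  have hsum : ∀ x : L2 w, (Summable fun k => tridiag a b c x (k + 1) ^ 2 / w.val (k + 1)) ∧
      ∑' k, tridiag a b c x (k + 1) ^ 2 / w.val (k + 1) ≤
        3 * B ^ 2 * (d₀ + 1 + c₀⁻¹) * ‖x‖ ^ 2 := fun x => by
    obtain ⟨s1, t1⟩ := summable_shift_right (y := fun k => x k ^ 2) (fun k hk => (hcd k hk).2)
      (fun k => sq_nonneg _) x.summable_sq
    obtain ⟨s2, t2⟩ := summable_shift_left (y := fun k => x k ^ 2) hc₀ (fun k hk => (hcd k hk).1)
      (fun k => sq_nonneg _) x.summable_sq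
    have s := ((s1.add x.summable_sq).add s2).mul_left (3 * B ^ 2)
    have s' := Summable.of_nonneg_of_le (fun k => div_nonneg (sq_nonneg _) (w.pos _).le) (hle x) s
    refine ⟨s', (s'.tsum_le_tsum (hle x) s).trans ?_⟩
    rw [tsum_mul_left, (s1.add x.summable_sq).tsum_add s2, s1.tsum_add x.summable_sq,
      mul_assoc (3 * B ^ 2)]
    have h3 : 0 ≤ 3 * B ^ 2 := by positivity
    refine mul_le_mul_of_nonneg_left ?_ h3
    simp only [x.apply_zero] at t1
    rw [← x.norm_sq_eq] at t1
    rw [← x.norm_sq_eq] at t2 ⊢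
    have : (0 : ℝ) ^ 2 / w.val 1 = 0 := by simp
    linarith
  let T₀ : L2 w →ₗ[ℝ] L2 w :=
    { toFun := fun x => ⟨tridiag a b c x, rfl, (hsum x).1⟩
      map_add' := fun x y => L2.ext fun k => by
        change tridiag a b c (x + y) k = tridiag a b c x k + tridiag a b c y k
        cases k with
        | zero => simp [tridiag]
        | succ k => simp only [tridiag, Pi.add_apply]; ring
      map_smul' := fun r x => L2.ext fun k => by
        change tridiag a b c (r • x) k = r * tridiag a b c x k
        cases k with
        | zero => simp [tridiag]
        | succ k => simp only [tridiag, Pi.smul_apply, smul_eq_mul]; ring }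
  have hT : ∀ x, ‖T₀ x‖ ≤ √(3 * (d₀ + 1 + c₀⁻¹)) * B * ‖x‖ := fun x => by
    have hpos : 0 ≤ 3 * (d₀ + 1 + c₀⁻¹) := by positivity
    refine (sq_le_sq₀ (norm_nonneg _) (by positivity)).1 ?_
    rw [L2.norm_sq_eq, mul_pow, mul_pow, Real.sq_sqrt hpos]
    exact (hsum x).2.trans (le_of_eq (by ring))
  exact ⟨T₀.mkContinuous _ hT, fun x k => rfl,
    LinearMap.mkContinuous_norm_le _ (by positivity) _⟩

theorem linK_eq_tridiag (α β : ℝ) (L : ℕ) (v x : ℕ → ℝ) :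
    linK α β L v x = tridiag (fun k => α * L * v k ^ (L - 1))
      (fun k => -(α * L * v (k + 1) ^ (L - 1) + β)) (fun _ => β) x := by
  funext k
  cases k with
  | zero => rfl
  | succ k => simp only [linK, tridiag]; ring

theorem tailSet.antitone {v : ℕ → ℝ} (hv : v ∈ tailSet) : Antitone v :=
  antitone_nat_of_succ_le hv.2.1

theorem tailSet.nonneg {v : ℕ → ℝ} (hv : v ∈ tailSet) (k : ℕ) : 0 ≤ v k :=
  (tailSet.antitone hv).le_of_tendsto hv.2.2 k

theorem tailSet.le_one {v : ℕ → ℝ} (hv : v ∈ tailSet) (k : ℕ) : v k ≤ 1 :=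
  hv.1 ▸ tailSet.antitone hv (Nat.zero_le k)

theorem exists_opK_bound {α β : ℝ} (hα : 0 < α) (hβ : 0 < β) (L : ℕ) {w : Weight}
    (hw : w.Comparable) :
    (∀ v ∈ tailSet, ∀ (x : L2 w) (k : ℕ), opK α β L w v x k = linK α β L v x k) ∧
      ∃ C : ℝ, ∀ v ∈ tailSet, ‖opK α β L w v‖ ≤ C := by
  obtain ⟨C, -, hC⟩ := exists_tridiag hw
  have key : ∀ v ∈ tailSet, ∃ T : L2 w →L[ℝ] L2 w, (∀ x k, T x k = linK α β L v x k) ∧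
      ‖T‖ ≤ C * (α * L + β) := fun v hv => by
    have hp : ∀ k, 0 ≤ v k ^ (L - 1) ∧ v k ^ (L - 1) ≤ 1 := fun k =>
      ⟨pow_nonneg (tailSet.nonneg hv k) _, pow_le_one₀ (tailSet.nonneg hv k) (tailSet.le_one hv k)⟩
    have hαL : 0 ≤ α * L := by positivity
    have hq : ∀ k, 0 ≤ α * L * v k ^ (L - 1) ∧ α * L * v k ^ (L - 1) ≤ α * L := fun k =>
      ⟨mul_nonneg hαL (hp k).1, mul_le_of_le_one_right hαL (hp k).2⟩
    simp_rw [linK_eq_tridiag]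
    refine hC _ _ _ _ (fun k => ?_) (fun k => ?_) (fun k => ?_)
    · rw [abs_of_nonneg (hq k).1]
      linarith [(hq k).2]
    · rw [abs_neg, abs_of_nonneg (by linarith [(hq (k + 1)).1])]
      linarith [(hq (k + 1)).2]
    · rw [abs_of_pos hβ]
      linarith
  have hspec : ∀ v ∈ tailSet, ∀ (x : L2 w) (k : ℕ), opK α β L w v x k = linK α β L v x k := by
    intro v hv
    obtain ⟨T, hT, -⟩ := key v hv
    have h : ∃ T : L2 w →L[ℝ] L2 w, ∀ x k, T x k = linK α β L v x k := ⟨T, hT⟩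
    rw [opK, dif_pos h]
    exact h.choose_spec
  refine ⟨hspec, C * (α * L + β), fun v hv => ?_⟩
  obtain ⟨T, hT, hn⟩ := key v hv
  have : opK α β L w v = T := by
    refine ContinuousLinearMap.ext fun x => L2.ext fun k => ?_
    rw [hspec v hv, hT]
  rwa [this]

theorem abs_pow_sub_pow_le {x y : ℝ} (hx0 : 0 ≤ x) (hx : x ≤ 1) (hy0 : 0 ≤ y) (hy : y ≤ 1)
    (n : ℕ) : |x ^ n - y ^ n| ≤ n * |x - y| := by
  induction n with
  | zero => simp
  | succ n ih =>
    have h : x ^ (n + 1) - y ^ (n + 1) = x ^ n * (x - y) + y * (x ^ n - y ^ n) := by ring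
    rw [h]
    refine (abs_add_le _ _).trans ?_
    rw [abs_mul, abs_mul, abs_of_nonneg hy0, abs_of_nonneg (pow_nonneg hx0 n)]
    have h1 := mul_le_of_le_one_left (abs_nonneg (x - y)) (pow_le_one₀ (n := n) hx0 hx)
    have h2 := mul_le_of_le_one_left (abs_nonneg (x ^ n - y ^ n)) hy
    push_cast
    linarith

/-- The terms in `β` cancel in the difference, leaving a tridiagonal matrix with differences of `v k
^ (L - 1)` below and on the diagonal and zero above it. -/
theorem exists_opK_lipschitz {α β : ℝ} (hα : 0 < α) (hβ : 0 < β) (L : ℕ) {w : Weight}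
    (hw : w.Comparable) :
    ∃ C : ℝ, 0 ≤ C ∧ ∀ v ∈ tailSet, ∀ v' ∈ tailSet, ∀ B, (∀ k, |v k - v' k| ≤ B) →
      ‖opK α β L w v - opK α β L w v'‖ ≤ C * B := by
  obtain ⟨C, hC0, hC⟩ := exists_tridiag hw
  have hspec := (exists_opK_bound hα hβ L hw).1
  refine ⟨C * (α * L * (L - 1 : ℕ)), by positivity, fun v hv v' hv' B hB => ?_⟩
  have hq : ∀ k, |α * L * v k ^ (L - 1) - α * L * v' k ^ (L - 1)| ≤
      α * L * (L - 1 : ℕ) * B := fun k => by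
    rw [← mul_sub, abs_mul, abs_of_nonneg (by positivity), mul_assoc (α * L)]
    refine mul_le_mul_of_nonneg_left ((abs_pow_sub_pow_le (tailSet.nonneg hv k)
      (tailSet.le_one hv k) (tailSet.nonneg hv' k) (tailSet.le_one hv' k) _).trans ?_)
      (by positivity)
    exact mul_le_mul_of_nonneg_left (hB k) (Nat.cast_nonneg _)
  have hB0 : 0 ≤ B := (abs_nonneg _).trans (hB 0)
  obtain ⟨T, hT, hn⟩ := hC (α * L * (L - 1 : ℕ) * B)
    (fun k => α * L * v k ^ (L - 1) - α * L * v' k ^ (L - 1))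
    (fun k => -(α * L * v (k + 1) ^ (L - 1) - α * L * v' (k + 1) ^ (L - 1))) (fun _ => 0)
    hq (fun k => by rw [abs_neg]; exact hq (k + 1)) (fun k => by rw [abs_zero]; positivity)
  have : opK α β L w v - opK α β L w v' = T := by
    refine ContinuousLinearMap.ext fun x => L2.ext fun k => ?_
    rw [hT]
    change opK α β L w v x k - opK α β L w v' x k = _
    rw [hspec v hv, hspec v' hv', linK_eq_tridiag, linK_eq_tridiag]
    cases k with
    | zero => simp [tridiag]
    | succ k => simp only [tridiag]; ring
  rw [this, mul_assoc]
  exact hn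

end OUQueue

namespace OUQueue

/-! ### Regularity and weighted `ℓ₁` bounds for the mean-field solution. -/

section MeanField

variable {α β : ℝ} {L : ℕ}

theorem Fplus_nonneg (hα : 0 < α) {v : ℕ → ℝ} (hv : v ∈ tailSet) (k : ℕ) : 0 ≤ Fplus α L v k := by
  cases k with
  | zero => exact le_rfl
  | succ k =>
    exact mul_nonneg hα.le
      (sub_nonneg.2 (pow_le_pow_left₀ (tailSet.nonneg hv _) (hv.2.1 k) L))

theorem Fminus_nonneg (hβ : 0 < β) {v : ℕ → ℝ} (hv : v ∈ tailSet) (k : ℕ) :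
    0 ≤ Fminus β v k := by
  cases k with
  | zero => exact le_rfl
  | succ k => exact mul_nonneg hβ.le (sub_nonneg.2 (hv.2.1 (k + 1)))

theorem Fplus_succ_le (hα : 0 < α) (hL : 1 ≤ L) {v : ℕ → ℝ} (hv : v ∈ tailSet) (k : ℕ) :
    Fplus α L v (k + 1) ≤ α * v k := by
  refine mul_le_mul_of_nonneg_left ?_ hα.le
  have h1 := pow_le_of_le_one (tailSet.nonneg hv k) (tailSet.le_one hv k) (by omega : L ≠ 0)
  have h2 := pow_nonneg (tailSet.nonneg hv (k + 1)) L
  linarith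

theorem Fminus_succ_le (hβ : 0 < β) {v : ℕ → ℝ} (hv : v ∈ tailSet) (k : ℕ) :
    Fminus β v (k + 1) ≤ β * v (k + 1) :=
  mul_le_mul_of_nonneg_left (sub_le_self _ (tailSet.nonneg hv _)) hβ.le

theorem abs_Fplus_sub_Fminus_le (hα : 0 < α) (hβ : 0 < β) {v : ℕ → ℝ} (hv : v ∈ tailSet) (k : ℕ) :
    |Fplus α L v k - Fminus β v k| ≤ Fplus α L v k + Fminus β v k := by
  have := Fplus_nonneg (L := L) hα hv k
  have := Fminus_nonneg hβ hv k
  rw [abs_le]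
  constructor <;> linarith

theorem Fplus_add_Fminus_le (hα : 0 < α) (hβ : 0 < β) (hL : 1 ≤ L) {v : ℕ → ℝ}
    (hv : v ∈ tailSet) (k : ℕ) : Fplus α L v k + Fminus β v k ≤ α + β := by
  cases k with
  | zero => simpa [Fplus, Fminus] using add_nonneg hα.le hβ.le
  | succ k =>
    have h1 := Fplus_succ_le hα hL hv k
    have h2 := Fminus_succ_le hβ hv k
    have h3 := mul_le_of_le_one_right hα.le (tailSet.le_one hv k)
    have h4 := mul_le_of_le_one_right hβ.le (tailSet.le_one hv (k + 1))
    linarith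

variable {u : ℝ → ℕ → ℝ}

/-- The constant does not depend on `k`; this uniformity turns coordinatewise differentiability into
norm continuity of the operators. -/
theorem IsMeanFieldSolution.abs_sub_le (hα : 0 < α) (hβ : 0 < β) (hL : 1 ≤ L)
    (hu : IsMeanFieldSolution α β L u) {s t : ℝ} (hs : 0 ≤ s) (ht : 0 ≤ t) (k : ℕ) :
    |u t k - u s k| ≤ (α + β) * |t - s| :=
  (convex_Ici (0 : ℝ)).norm_image_sub_le_of_norm_hasDerivWithin_le (f := fun s => u s k)
    (fun r hr => hu.2 r hr k)
    (fun r hr => (abs_Fplus_sub_Fminus_le hα hβ (hu.1 r hr) k).trans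
      (Fplus_add_Fminus_le hα hβ hL (hu.1 r hr) k)) hs ht

theorem IsMeanFieldSolution.continuousOn (hu : IsMeanFieldSolution α β L u) (k : ℕ) :
    ContinuousOn (fun s => u s k) (Set.Ici 0) :=
  fun t ht => (hu.2 t ht k).continuousWithinAt

theorem IsMeanFieldSolution.continuousOn_bracket (hu : IsMeanFieldSolution α β L u) (k : ℕ) :
    ContinuousOn (fun s => Fplus α L (u s) k + Fminus β (u s) k) (Set.Ici 0) := by
  cases k with
  | zero =>
    simp only [Fplus, Fminus]
    exact continuousOn_const
  | succ k =>
    have h0 := hu.continuousOn k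
    have h1 := hu.continuousOn (k + 1)
    have h2 := hu.continuousOn (k + 2)
    simp only [Fplus, Fminus]
    fun_prop

theorem IsMeanFieldSolution.intervalIntegrable_bracket (hu : IsMeanFieldSolution α β L u) (k : ℕ)
    {t : ℝ} (ht : 0 ≤ t) :
    IntervalIntegrable (fun s => Fplus α L (u s) k + Fminus β (u s) k) volume 0 t := by
  refine ContinuousOn.intervalIntegrable ((hu.continuousOn_bracket k).mono ?_)
  rw [Set.uIcc_of_le ht]
  exact fun x hx => hx.1

/-- The operators along the solution, extended to negative times. -/
noncomputable def pathK (α β : ℝ) (L : ℕ) (w : Weight) (u : ℝ → ℕ → ℝ) (r : ℝ) : L2 w →L[ℝ] L2 w :=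
  opK α β L w (u (max r 0))

theorem pathK_of_nonneg {w : Weight} {r : ℝ} (hr : 0 ≤ r) :
    pathK α β L w u r = opK α β L w (u r) := by rw [pathK, max_eq_left hr]

theorem continuous_pathK (hα : 0 < α) (hβ : 0 < β) (hL : 1 ≤ L) {w : Weight}
    (hw : w.Comparable) (hu : IsMeanFieldSolution α β L u) : Continuous (pathK α β L w u) := by
  obtain ⟨C, hC0, hC⟩ := exists_opK_lipschitz hα hβ L hw
  suffices h : LipschitzWith (C * (α + β)).toNNReal (pathK α β L w u) from h.continuous
  refine LipschitzWith.of_dist_le' fun x y => ?_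
  rw [dist_eq_norm, mul_assoc]
  refine hC _ (hu.1 _ (le_max_right _ _)) _ (hu.1 _ (le_max_right _ _)) _ fun k => ?_
  refine (hu.abs_sub_le hα hβ hL (le_max_right _ _) (le_max_right _ _) k).trans ?_
  rw [Real.dist_eq]
  exact mul_le_mul_of_nonneg_left (abs_max_sub_max_le_abs x y 0) (add_pos hα hβ).le

theorem exists_pathK_bound (hα : 0 < α) (hβ : 0 < β) {w : Weight}
    (hw : w.Comparable) (hu : IsMeanFieldSolution α β L u) :
    ∃ C : ℝ, ∀ r, ‖pathK α β L w u r‖ ≤ C := by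
  obtain ⟨C, hC⟩ := (exists_opK_bound hα hβ L hw).2
  exact ⟨C, fun r => hC _ (hu.1 _ (le_max_right _ _))⟩

theorem sum_shift_le {w : Weight} {d : ℝ} (hd0 : 0 < d)
    (hd : ∀ k : ℕ, 1 ≤ k → w.val k ≤ d * w.val (k + 1)) {v : ℕ → ℝ} (hv : v ∈ tailSet) (n : ℕ) :
    ∑ k ∈ Finset.range n, v k / w.val (k + 1) ≤
      1 / w.val 1 + d * ∑ k ∈ Finset.range n, v (k + 1) / w.val (k + 1) := by
  have hpos : ∀ k, 0 ≤ v (k + 1) / w.val (k + 1) :=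
    fun k => div_nonneg (tailSet.nonneg hv _) (w.pos k).le
  cases n with
  | zero => simpa using (w.pos 0).le
  | succ n =>
    rw [Finset.sum_range_succ', add_comm, hv.1]
    refine add_le_add le_rfl ?_
    rw [Finset.mul_sum, Finset.sum_range_succ]
    refine le_add_of_le_of_nonneg (Finset.sum_le_sum fun k _ => ?_) (mul_nonneg hd0.le (hpos n))
    have h1 := w.pos k
    have h2 := w.pos (k + 1)
    rw [← mul_div_assoc, div_le_div_iff₀ h2 h1]
    nlinarith [mul_le_mul_of_nonneg_left (hd (k + 1) (by omega)) (tailSet.nonneg hv (k + 1))]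

/-- Dropping the negative parts of `Fplus` and `Fminus` leaves only coordinates inside the
truncation, so the estimate closes at fixed `n`; the last term comes from `v 0 = 1`. -/
theorem sum_bracket_le (hα : 0 < α) (hβ : 0 < β) (hL : 1 ≤ L) {w : Weight} {d : ℝ} (hd0 : 0 < d)
    (hd : ∀ k : ℕ, 1 ≤ k → w.val k ≤ d * w.val (k + 1)) {v : ℕ → ℝ} (hv : v ∈ tailSet) (n : ℕ) :
    ∑ k ∈ Finset.range n, (Fplus α L v (k + 1) + Fminus β v (k + 1)) / w.val (k + 1) ≤
      (α * d + β) * (∑ k ∈ Finset.range n, v (k + 1) / w.val (k + 1)) + α / w.val 1 := by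
  have h : ∑ k ∈ Finset.range n, (Fplus α L v (k + 1) + Fminus β v (k + 1)) / w.val (k + 1) ≤
      ∑ k ∈ Finset.range n, (α * (v k / w.val (k + 1)) + β * (v (k + 1) / w.val (k + 1))) := by
    refine Finset.sum_le_sum fun k _ => ?_
    rw [← mul_div_assoc, ← mul_div_assoc, ← add_div]
    exact div_le_div_of_nonneg_right (add_le_add (Fplus_succ_le hα hL hv k)
      (Fminus_succ_le hβ hv k)) (w.pos k).le
  rw [Finset.sum_add_distrib, ← Finset.mul_sum, ← Finset.mul_sum] at h
  have h2 := mul_le_mul_of_nonneg_left (sum_shift_le hd0 hd hv n) hα.le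
  have h3 : α / w.val 1 = α * (1 / w.val 1) := by ring
  rw [h3]
  linarith

/-- Grönwall for the truncated weighted norm. Finite sums avoid differentiating a series, and the
bound is uniform in `n`. -/
theorem IsMeanFieldSolution.sum_le (hα : 0 < α) (hβ : 0 < β) (hL : 1 ≤ L) {w : Weight} {d : ℝ}
    (hd0 : 0 < d) (hd : ∀ k : ℕ, 1 ≤ k → w.val k ≤ d * w.val (k + 1))
    (hu : IsMeanFieldSolution α β L u) (h0 : Summable fun k => |u 0 (k + 1)| / w.val (k + 1))
    {t : ℝ} (ht : 0 ≤ t) (n : ℕ) :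
    ∑ k ∈ Finset.range n, u t (k + 1) / w.val (k + 1) ≤
      gronwallBound (∑' k, |u 0 (k + 1)| / w.val (k + 1)) (α * d + β) (α / w.val 1) t := by
  have hder : ∀ r, 0 ≤ r →
      HasDerivWithinAt (fun r => ∑ k ∈ Finset.range n, u r (k + 1) / w.val (k + 1))
        (∑ k ∈ Finset.range n, (Fplus α L (u r) (k + 1) - Fminus β (u r) (k + 1)) / w.val (k + 1))
        (Set.Ici 0) r := fun r hr =>
    HasDerivWithinAt.fun_sum fun k _ => (hu.2 r hr (k + 1)).div_const _
  have hnn : ∀ r, 0 ≤ r → 0 ≤ ∑ k ∈ Finset.range n, u r (k + 1) / w.val (k + 1) := fun r hr =>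
    Finset.sum_nonneg fun k _ => div_nonneg (tailSet.nonneg (hu.1 r hr) _) (w.pos k).le
  have key := norm_le_gronwallBound_of_norm_deriv_right_le (a := 0) (b := t)
    (δ := ∑' k, |u 0 (k + 1)| / w.val (k + 1)) (K := α * d + β) (ε := α / w.val 1)
    (fun r hr => (hder r hr.1).continuousWithinAt.mono fun x hx => hx.1)
    (fun r hr => (hder r hr.1).mono (Set.Ici_subset_Ici.2 hr.1)) ?_ ?_ t ⟨ht, le_rfl⟩
  · rw [Real.norm_of_nonneg (hnn t ht), sub_zero] at key
    exact key
  · rw [Real.norm_of_nonneg (hnn 0 le_rfl)]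
    refine (Finset.sum_le_sum fun k _ => ?_).trans
      (h0.sum_le_tsum (Finset.range n) fun k _ => div_nonneg (abs_nonneg _) (w.pos k).le)
    exact div_le_div_of_nonneg_right (le_abs_self _) (w.pos k).le
  · intro r hr
    rw [Real.norm_of_nonneg (hnn r hr.1)]
    refine le_trans ?_ (sum_bracket_le hα hβ hL hd0 hd (hu.1 r hr.1) n)
    refine (norm_sum_le _ _).trans (Finset.sum_le_sum fun k _ => ?_)
    rw [Real.norm_eq_abs, abs_div, abs_of_pos (w.pos k)]
    exact div_le_div_of_nonneg_right (abs_Fplus_sub_Fminus_le hα hβ (hu.1 r hr.1) _) (w.pos k).le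

theorem IsMeanFieldSolution.summable_bracket (hα : 0 < α) (hβ : 0 < β) (hL : 1 ≤ L) {w : Weight}
    (hw : w.Comparable) (hu : IsMeanFieldSolution α β L u)
    (h0 : Summable fun k => |u 0 (k + 1)| / w.val (k + 1)) {T : ℝ} (hT : 0 ≤ T) :
    Summable fun k => (∫ s in (0 : ℝ)..T, (Fplus α L (u s) (k + 1) + Fminus β (u s) (k + 1)))
      / w.val (k + 1) := by
  obtain ⟨_, d, -, hd0, hcd⟩ := hw
  have hd : ∀ k : ℕ, 1 ≤ k → w.val k ≤ d * w.val (k + 1) := fun k hk => (hcd k hk).2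
  have hnn : ∀ s, 0 ≤ s → ∀ k, 0 ≤ Fplus α L (u s) k + Fminus β (u s) k := fun s hs k =>
    add_nonneg (Fplus_nonneg hα (hu.1 s hs) k) (Fminus_nonneg hβ (hu.1 s hs) k)
  have hε : 0 ≤ α / w.val 1 := div_nonneg hα.le (w.pos 0).le
  have hK : 0 ≤ α * d + β := by positivity
  set D := ∑' k, |u 0 (k + 1)| / w.val (k + 1) with hD
  have hD0 : 0 ≤ D := tsum_nonneg fun k => div_nonneg (abs_nonneg _) (w.pos k).le
  refine summable_of_sum_range_le (c := ((α * d + β) * gronwallBound D (α * d + β) (α / w.val 1) T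
    + α / w.val 1) * T) (fun k => div_nonneg
      (intervalIntegral.integral_nonneg hT fun s hs => hnn s hs.1 _) (w.pos k).le) fun n => ?_
  have hi : ∀ k, IntervalIntegrable
      (fun s => (Fplus α L (u s) (k + 1) + Fminus β (u s) (k + 1)) / w.val (k + 1)) volume 0 T :=
    fun k => (hu.intervalIntegrable_bracket (k + 1) hT).div_const _
  simp_rw [← intervalIntegral.integral_div]
  rw [← intervalIntegral.integral_finsetSum fun k _ => hi k]
  have hle := intervalIntegral.integral_mono_on hT
    (IntervalIntegrable.sum (Finset.range n) fun k _ => hi k)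
    (intervalIntegrable_const (c := (α * d + β) * gronwallBound D (α * d + β) (α / w.val 1) T
      + α / w.val 1)) fun s hs => ?_
  · rw [intervalIntegral.integral_const, smul_eq_mul, sub_zero, mul_comm T] at hle
    simpa using hle
  · rw [Finset.sum_apply]
    refine (sum_bracket_le hα hβ hL hd0 hd (hu.1 s hs.1) n).trans ?_
    gcongr
    refine (hu.sum_le hα hβ hL hd0 hd h0 hs.1 n).trans ?_
    exact gronwallBound_mono hD0 hε hK hs.2

end MeanField

end OUQueue

/-! ### Doob's maximal inequality in `L²`. -/

namespace OUQueue

/-- The running maximum of a sequence. -/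
noncomputable def runMax (s : ℕ → ℝ) : ℕ → ℝ
  | 0 => s 0
  | n + 1 => max (runMax s n) (s (n + 1))

theorem le_runMax (s : ℕ → ℝ) {i n : ℕ} (h : i ≤ n) : s i ≤ runMax s n := by
  induction n with
  | zero => rw [Nat.le_zero.1 h, runMax]
  | succ n ih =>
    rcases Nat.le_succ_iff.1 h with h | rfl
    · exact (ih h).trans (le_max_left _ _)
    · exact le_max_right _ _

/-- The pathwise form of Doob's maximal inequality in `L²`. -/
theorem runMax_sq_add_le (s : ℕ → ℝ) (n : ℕ) :
    runMax s n ^ 2 + 4 * ∑ i ∈ Finset.range n, runMax s i * (s (i + 1) - s i) ≤ 4 * s n ^ 2 := by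
  -- Summation by parts: whenever the running maximum moves it equals the current value, so its
  -- increments produce at least half of its square. Completing the square in `runMax s n - 2 * s n`
  -- then gives the factor 4.
  have key : ∑ i ∈ Finset.range n, runMax s i * (s (i + 1) - s i) ≤
      runMax s n * s n - runMax s n ^ 2 / 2 := by
    induction n with
    | zero => simp only [Finset.range_zero, Finset.sum_empty, runMax]; nlinarith [sq_nonneg (s 0)]
    | succ n ih =>
      rw [Finset.sum_range_succ, runMax]
      rcases max_cases (runMax s n) (s (n + 1)) with ⟨h, -⟩ | ⟨h, -⟩ <;> rw [h]
      · linarith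
      · nlinarith [sq_nonneg (runMax s n - s (n + 1))]
  nlinarith [sq_nonneg (runMax s n - 2 * s n)]

section Doob

variable {Ω : Type*} {mΩ : MeasurableSpace Ω} {P : Measure Ω} [IsProbabilityMeasure P]
  {ℱ : Filtration ℝ≥0 mΩ} {M : ℝ≥0 → Ω → ℝ}

/-- One step of a martingale transform: a nonnegative integrand known at time `a`, against a
submartingale increment. -/
theorem integral_mul_sub_nonneg (hM : Submartingale M ℱ P) (h2 : ∀ t, MemLp (M t) 2 P) {a b : ℝ≥0}
    (hab : a ≤ b) {X : Ω → ℝ} (hX : StronglyMeasurable[ℱ a] X) (hX2 : MemLp X 2 P)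
    (hX0 : ∀ ω, 0 ≤ X ω) : 0 ≤ ∫ ω, X ω * (M b ω - M a ω) ∂P := by
  have hib : Integrable (fun ω => X ω * M b ω) P := hX2.integrable_mul (h2 b)
  have hia : Integrable (fun ω => X ω * M a ω) P := hX2.integrable_mul (h2 a)
  have h1 := condExp_mul_of_stronglyMeasurable_left hX hib (hM.integrable b)
  have h3 : ∫ ω, X ω * M b ω ∂P = ∫ ω, (X * P[M b|ℱ a]) ω ∂P := by
    rw [← integral_condExp (ℱ.le a)]
    exact integral_congr_ae h1
  have hic : Integrable (X * P[M b|ℱ a]) P := integrable_condExp.congr h1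
  simp_rw [mul_sub]
  rw [integral_sub hib hia, h3, sub_nonneg]
  refine integral_mono_ae hia hic ?_
  filter_upwards [hM.ae_le_condExp hab] with ω hω
  exact mul_le_mul_of_nonneg_left hω (hX0 ω)

theorem stronglyMeasurable_runMax {m : MeasurableSpace Ω} {f : ℕ → Ω → ℝ} {n : ℕ}
    (hf : ∀ i ≤ n, StronglyMeasurable[m] (f i)) :
    StronglyMeasurable[m] fun ω => runMax (fun i => f i ω) n := by
  induction n with
  | zero => exact hf 0 le_rfl
  | succ n ih => exact (ih fun i hi => hf i (hi.trans n.le_succ)).sup (hf (n + 1) le_rfl)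

omit [IsProbabilityMeasure P] in
theorem memLp_runMax {f : ℕ → Ω → ℝ} (hf : ∀ i, MemLp (f i) 2 P) (n : ℕ) :
    MemLp (fun ω => runMax (fun i => f i ω) n) 2 P := by
  induction n with
  | zero => exact hf 0
  | succ n ih => exact ih.sup (hf (n + 1))

/-- Expectation of the pathwise inequality for `|M|`: the transform term has nonnegative mean and is
discarded. -/
theorem integral_runMax_sq_le (hM : Martingale M ℱ P) (h2 : ∀ t, MemLp (M t) 2 P) {τ : ℕ → ℝ≥0}
    (hτ : Monotone τ) (n : ℕ) :
    ∫ ω, runMax (fun i => |M (τ i) ω|) n ^ 2 ∂P ≤ 4 * ∫ ω, M (τ n) ω ^ 2 ∂P := by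
  have hs : Submartingale (fun t ω => |M t ω|) ℱ P := hM.submartingale.sup hM.neg.submartingale
  have hs2 : ∀ t, MemLp (fun ω => |M t ω|) 2 P := fun t => (h2 t).abs
  have hr := memLp_runMax (fun i => hs2 (τ i))
  have hi : ∀ i, Integrable (fun ω => runMax (fun i => |M (τ i) ω|) i *
      (|M (τ (i + 1)) ω| - |M (τ i) ω|)) P := fun i =>
    (hr i).integrable_mul ((hs2 _).sub (hs2 _))
  have hnn : ∀ i, 0 ≤ ∫ ω, runMax (fun i => |M (τ i) ω|) i *
      (|M (τ (i + 1)) ω| - |M (τ i) ω|) ∂P := fun i =>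
    integral_mul_sub_nonneg hs hs2 (hτ i.le_succ)
      (stronglyMeasurable_runMax fun j hj => (hs.stronglyMeasurable _).mono (ℱ.mono (hτ hj)))
      (hr i) fun ω => (abs_nonneg _).trans (le_runMax (fun i => |M (τ i) ω|) le_rfl)
  have hsum : Integrable (fun ω => 4 * ∑ i ∈ Finset.range n, runMax (fun i => |M (τ i) ω|) i *
      (|M (τ (i + 1)) ω| - |M (τ i) ω|)) P :=
    (integrable_finsetSum _ fun i _ => hi i).const_mul 4
  have h := integral_mono ((hr n).integrable_sq.add hsum) ((h2 (τ n)).integrable_sq.const_mul 4)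
    fun ω => (by
      have := runMax_sq_add_le (fun i => |M (τ i) ω|) n
      rw [sq_abs] at this
      exact this)
  simp only [Pi.add_apply] at h
  rw [integral_add (hr n).integrable_sq hsum, integral_const_mul, integral_const_mul,
    integral_finsetSum _ fun i _ => hi i] at h
  linarith [Finset.sum_nonneg fun i (_ : i ∈ Finset.range n) => hnn i]

/-- Doob's maximal inequality in `L²` for martingales with continuous paths. -/
theorem exists_lintegral_sup_sq_le (hM : Martingale M ℱ P) (h2 : ∀ t, MemLp (M t) 2 P)
    (hc : ∀ᵐ ω ∂P, Continuous fun t => M t ω) (T : ℝ≥0) :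
    ∃ G : Ω → ℝ≥0∞, Measurable G ∧ ∫⁻ ω, G ω ∂P ≤ ENNReal.ofReal (4 * ∫ ω, M T ω ^ 2 ∂P) ∧
      ∀ᵐ ω ∂P, ∀ t ≤ T, ENNReal.ofReal (M t ω ^ 2) ≤ G ω := by
  let τ : ℕ → ℕ → ℝ≥0 := fun n i => T * (i / 2 ^ n)
  have hτ : ∀ n, Monotone (τ n) := fun n i j hij => by
    have : (i : ℝ≥0) ≤ j := by exact_mod_cast hij
    simp only [τ]
    gcongr
  have hτn : ∀ n, τ n (2 ^ n) = T := fun n => by simp [τ]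
  let R : ℕ → Ω → ℝ≥0∞ := fun n ω =>
    ENNReal.ofReal (runMax (fun i => |M (τ n i) ω|) (2 ^ n) ^ 2)
  have hRm : ∀ n, Measurable (R n) := fun n =>
    ((stronglyMeasurable_runMax fun j _ =>
      ((hM.stronglyMeasurable (τ n j)).mono (ℱ.le _)).norm).measurable.pow_const 2).ennreal_ofReal
  have hR : ∀ n, ∫⁻ ω, R n ω ∂P ≤ ENNReal.ofReal (4 * ∫ ω, M T ω ^ 2 ∂P) := fun n => by
    have hr : MemLp (fun ω => runMax (fun i => |M (τ n i) ω|) (2 ^ n)) 2 P :=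
      memLp_runMax (fun i => (h2 (τ n i)).abs) (2 ^ n)
    have h := integral_runMax_sq_le hM h2 (hτ n) (2 ^ n)
    rw [hτn] at h
    simp only [R]
    rw [← ofReal_integral_eq_lintegral_ofReal hr.integrable_sq
      (Eventually.of_forall fun ω => sq_nonneg _)]
    exact ENNReal.ofReal_le_ofReal h
  -- Fatou bounds the mean of the liminf of the dyadic maxima, and this measurable majorant replaces
  -- a supremum over uncountably many times.
  refine ⟨fun ω => liminf (fun n => R n ω) atTop, Measurable.liminf hRm,
    (lintegral_liminf_le hRm).trans ?_, ?_⟩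
  · exact (liminf_le_liminf (Eventually.of_forall hR)).trans (by rw [liminf_const])
  · filter_upwards [hc] with ω hω t ht
    -- `T = 0` is treated apart since the grid points below `t` are located through `t / T`.
    rcases eq_or_ne T 0 with rfl | hT
    · have ht0 : t = 0 := le_antisymm ht zero_le
      have hle : ∀ n, ENNReal.ofReal (M t ω ^ 2) ≤ R n ω := fun n => by
        have h := le_runMax (fun i => |M (τ n i) ω|) (Nat.zero_le (2 ^ n))
        have h0 : τ n 0 = t := by simp [τ, ht0]
        simp only [h0] at h
        refine ENNReal.ofReal_le_ofReal ?_
        rw [← sq_abs]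
        exact pow_le_pow_left₀ (abs_nonneg _) h 2
      exact le_liminf_of_le (by isBoundedDefault) (Eventually.of_forall hle)
    · let i : ℕ → ℕ := fun n => ⌊((t / T : ℝ≥0) : ℝ) * 2 ^ n⌋₊
      have hi : ∀ n, i n ≤ 2 ^ n := fun n => by
        have h1 : t / T ≤ 1 := div_le_one_of_le₀ ht zero_le
        have h3 : ((t / T : ℝ≥0) : ℝ) * 2 ^ n ≤ ((2 ^ n : ℕ) : ℝ) := by
          rw [Nat.cast_pow, Nat.cast_ofNat]
          exact mul_le_of_le_one_left (by positivity) (by exact_mod_cast h1)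
        exact (Nat.floor_le_floor h3).trans (Nat.floor_natCast _).le
      have hlim : Tendsto (fun n => τ n (i n)) atTop (𝓝 t) := by
        have h1 := (tendsto_nat_floor_mul_div_atTop (R := ℝ) (a := ((t / T : ℝ≥0) : ℝ))
          (NNReal.coe_nonneg _)).comp (tendsto_pow_atTop_atTop_of_one_lt one_lt_two)
        have h3 : Tendsto (fun n => ((i n : ℝ≥0) / 2 ^ n)) atTop (𝓝 (t / T)) := by
          rw [← NNReal.tendsto_coe]
          exact h1.congr fun n => by simp [i]
        have h5 := h3.const_mul T
        rwa [mul_div_cancel₀ _ hT] at h5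
      have hlim2 : Tendsto (fun n => ENNReal.ofReal (M (τ n (i n)) ω ^ 2)) atTop
          (𝓝 (ENNReal.ofReal (M t ω ^ 2))) :=
        ENNReal.tendsto_ofReal (((hω.tendsto t).comp hlim).pow 2)
      rw [← hlim2.liminf_eq]
      refine liminf_le_liminf (Eventually.of_forall fun n => ENNReal.ofReal_le_ofReal ?_)
      rw [← sq_abs]
      exact pow_le_pow_left₀ (abs_nonneg _) (le_runMax (fun i => |M (τ n i) ω|) (hi n)) 2

end Doob

end OUQueue

namespace OUQueue

/-! ### Convergence of Riemann sums along a path, and uniqueness for the integral equation. -/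

section Pathwise

variable {E : Type*} [NormedAddCommGroup E] [NormedSpace ℝ E]

/-- The left-point Riemann sum of `∫ Φ dm` over the subdivision `τ 0 ≤ ⋯ ≤ τ n`. -/
def riemannSum (Φ : ℝ → E →L[ℝ] E) (m : ℝ≥0 → E) (n : ℕ) (τ : ℕ → ℝ≥0) : E :=
  ∑ i ∈ Finset.range n, Φ (τ i) (m (τ (i + 1)) - m (τ i))

theorem tendsto_one_div_add_one : Tendsto (fun j : ℕ => 1 / ((j : ℝ≥0) + 1)) atTop (𝓝 0) := by
  rw [← NNReal.tendsto_coe]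
  exact (tendsto_one_div_add_atTop_nhds_zero_nat (𝕜 := ℝ)).congr fun j => by push_cast; rfl

theorem continuous_comp_toNNReal {X : Type*} [TopologicalSpace X] {m : ℝ≥0 → X}
    (hm : Continuous m) : Continuous fun r : ℝ => m r.toNNReal := hm.comp continuous_real_toNNReal

variable [CompleteSpace E] {A : ℝ → E →L[ℝ] E} {C : ℝ}

theorem norm_riemannSum_sub_le (hA : Continuous A) (hC : ∀ r, ‖A r‖ ≤ C) {m : ℝ≥0 → E}
    (hm : Continuous m) (hm0 : m 0 = 0) {t : ℝ≥0} {η : ℝ} {n : ℕ}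
    {τ : ℕ → ℝ≥0} (hτ : Monotone τ) (hτ0 : τ 0 = 0) (hτn : τ n = t)
    (hη : ∀ i < n, ∀ r, τ i ≤ r → r ≤ τ (i + 1) → ‖m (τ (i + 1)) - m r‖ ≤ η) :
    ‖riemannSum (fun s => timeOrderedExp A t s) m n τ - duhamel A (fun r => m r.toNNReal) t‖
      ≤ Real.exp (C * t) * C * t * η := by
  have h := norm_riemannSum_sub_duhamel_le hA hC (continuous_comp_toNNReal hm)
    (by simpa using hm0) (t := t) (η := η) (n := n) (τ := fun i => (τ i : ℝ))
    (fun i j hij => NNReal.coe_le_coe.2 (hτ hij)) (by simp [hτ0]) (by simp [hτn])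
    fun i hi r h1 h2 => by
      have hr : 0 ≤ r := (NNReal.coe_nonneg _).trans h1
      lift r to ℝ≥0 using hr
      simp only [Real.toNNReal_coe]
      exact hη i hi r (by exact_mod_cast h1) (by exact_mod_cast h2)
  simpa only [Real.toNNReal_coe, riemannSum] using h

theorem tendsto_riemannSum (hA : Continuous A) (hC : ∀ r, ‖A r‖ ≤ C) {m : ℝ≥0 → E}
    (hm : Continuous m) (hm0 : m 0 = 0) {t : ℝ≥0} {n : ℕ → ℕ} {τ : ℕ → ℕ → ℝ≥0} {δ : ℕ → ℝ≥0}
    (hτ : ∀ j, Monotone (τ j)) (hτ0 : ∀ j, τ j 0 = 0) (hτn : ∀ j, τ j (n j) = t)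
    (hδ : Tendsto δ atTop (𝓝 0)) (hτδ : ∀ j, ∀ i < n j, τ j (i + 1) ≤ τ j i + δ j) :
    Tendsto (fun j => riemannSum (fun s => timeOrderedExp A t s) m (n j) (τ j)) atTop
      (𝓝 (duhamel A (fun r => m r.toNNReal) t)) := by
  have hC0 : 0 ≤ C := (norm_nonneg _).trans (hC 0)
  rw [Metric.tendsto_atTop]
  intro ε hε
  set c := Real.exp (C * t) * C * t with hc
  have hc0 : 0 ≤ c := by positivity
  have huc := (isCompact_Icc (a := (0 : ℝ≥0)) (b := t)).uniformContinuousOn_of_continuous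
    hm.continuousOn
  rw [Metric.uniformContinuousOn_iff] at huc
  -- Uniform continuity of the path on `[0,t]` bounds the cell oscillation; `c + 1` instead of `c`
  -- allows `c = 0`.
  obtain ⟨d, hd, H⟩ := huc (ε / (c + 1)) (by positivity)
  have hev : ∀ᶠ j in atTop, δ j < d.toNNReal :=
    hδ.eventually_lt_const (Real.toNNReal_pos.2 hd)
  obtain ⟨j₀, hj₀⟩ := eventually_atTop.1 hev
  refine ⟨j₀, fun j hj => ?_⟩
  rw [dist_eq_norm]
  refine (norm_riemannSum_sub_le hA hC hm hm0 (hτ j) (hτ0 j) (hτn j) (η := ε / (c + 1))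
    fun i hi r h1 h2 => ?_).trans_lt ?_
  · have h3 : τ j (i + 1) ≤ t := hτn j ▸ hτ j hi
    rw [← dist_eq_norm]
    refine (H _ ⟨zero_le, h3⟩ _ ⟨zero_le, h2.trans h3⟩ ?_).le
    rw [NNReal.dist_eq, abs_of_nonneg (sub_nonneg.2 (NNReal.coe_le_coe.2 h2))]
    have h4 : ((τ j (i + 1) : ℝ≥0) : ℝ) ≤ τ j i + δ j := by exact_mod_cast hτδ j i hi
    have h5 : (δ j : ℝ) < d := (Real.lt_toNNReal_iff_coe_lt).1 (hj₀ j hj)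
    have h6 : (τ j i : ℝ) ≤ r := by exact_mod_cast h1
    linarith
  · rw [← hc, ← mul_div_assoc, div_lt_iff₀ (by positivity)]
    nlinarith

omit [CompleteSpace E] in
theorem bound_nonneg (hC : ∀ r, ‖A r‖ ≤ C) : 0 ≤ C := (norm_nonneg _).trans (hC 0)

omit [CompleteSpace E] in
theorem intervalIntegrable_clm_apply (hA : Continuous A) (hC : ∀ r, ‖A r‖ ≤ C) {z : ℝ → E}
    {a b : ℝ} (hz : IntervalIntegrable z volume a b) :
    IntervalIntegrable (fun s => A s (z s)) volume a b :=
  IntervalIntegrable.mono_fun' (hz.norm.const_mul C)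
    (ContinuousLinearMap.aestronglyMeasurable_comp₂
      (ContinuousLinearMap.id ℝ (E →L[ℝ] E)) hA.aestronglyMeasurable hz.def'.aestronglyMeasurable)
    (Eventually.of_forall fun s => (A s).le_of_opNorm_le (hC s) _)

/-- Bootstrapping from mere integrability: the integral equation makes `D` continuous, then
differentiable, and uniqueness for the linear equation applies. Vanishing at negative times extends
the integral formula to the whole line. -/
theorem eq_zero_of_eq_integral (hA : Continuous A) (hC : ∀ r, ‖A r‖ ≤ C) {D : ℝ → E}
    (hneg : ∀ s ≤ 0, D s = 0) (hint : ∀ t : ℝ, 0 ≤ t → IntervalIntegrable D volume 0 t)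
    (hD : ∀ t : ℝ, 0 ≤ t → D t = ∫ s in (0 : ℝ)..t, A s (D s)) {t : ℝ} (ht : 0 ≤ t) : D t = 0 := by
  have hf0 : ∀ b, IntervalIntegrable (fun s => A s (D s)) volume 0 b := fun b => by
    rcases le_total 0 b with hb | hb
    · exact intervalIntegrable_clm_apply hA hC (hint b hb)
    · refine (intervalIntegrable_const (c := (0 : E))).congr fun s hs => ?_
      rw [Set.uIoc_of_ge hb] at hs
      simp only [hneg s hs.2, map_zero]
  have hf : ∀ a b, IntervalIntegrable (fun s => A s (D s)) volume a b :=
    fun a b => (hf0 a).symm.trans (hf0 b)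
  have hD' : D = fun t => ∫ s in (0 : ℝ)..t, A s (D s) := by
    funext b
    rcases le_total 0 b with hb | hb
    · exact hD b hb
    · rw [hneg b hb, intervalIntegral.integral_congr (g := fun _ => (0 : E)) fun s hs => ?_]
      · simp
      · rw [Set.uIcc_of_ge hb] at hs
        simp only [hneg s hs.2, map_zero]
  have hc : Continuous D := by
    rw [hD']
    exact intervalIntegral.continuous_primitive hf 0
  have hfc : Continuous fun s => A s (D s) := hA.clm_apply hc
  have hder : IsLinearSolution A 0 D := fun t _ => by
    have h := intervalIntegral.integral_hasDerivAt_right (hf 0 t)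
      (hfc.stronglyMeasurableAtFilter _ _) hfc.continuousAt
    rw [← hD'] at h
    exact h.hasDerivWithinAt
  have hzero : IsLinearSolution A 0 fun _ => (0 : E) := fun t _ => by
    rw [map_zero]
    exact hasDerivWithinAt_const _ _ _
  exact hder.unique (fun r _ => hC r) hzero (hneg 0 le_rfl) ht

end Pathwise

/-! ### From pathwise to `L²` convergence: the Wiener-type integral. -/

section Stochastic

variable {Ω : Type*} {mΩ : MeasurableSpace Ω} {P : Measure Ω}

/-- Here `m` may be smaller than the σ-field of `P`, and the exceptional null set need not lie in
it; taking `limUnder` of `m`-measurable versions everywhere avoids this. -/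
theorem aestronglyMeasurable_of_tendsto {E : Type*} [TopologicalSpace E]
    [TopologicalSpace.IsCompletelyMetrizableSpace E] [Nonempty E] {m : MeasurableSpace Ω}
    {f : ℕ → Ω → E} {g : Ω → E} (hf : ∀ n, AEStronglyMeasurable[m] (f n) P)
    (hfg : ∀ᵐ ω ∂P, Tendsto (fun n => f n ω) atTop (𝓝 (g ω))) : AEStronglyMeasurable[m] g P := by
  choose f' hf' hff' using hf
  refine ⟨fun ω => limUnder atTop fun n => f' n ω, StronglyMeasurable.limUnder hf', ?_⟩
  filter_upwards [hfg, ae_all_iff.2 hff'] with ω h1 h2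
  exact (h1.congr h2).limUnder_eq.symm

variable {E : Type*} [NormedAddCommGroup E]

theorem memLp_two_of_le {f : Ω → E} {G : Ω → ℝ≥0∞} (hf : AEStronglyMeasurable f P)
    (hG : ∫⁻ ω, G ω ∂P < ∞) (hfG : ∀ᵐ ω ∂P, ‖f ω‖ₑ ^ 2 ≤ G ω) : MemLp f 2 P := by
  refine ⟨hf, ?_⟩
  rw [eLpNorm_lt_top_iff_lintegral_rpow_enorm_lt_top (by norm_num) (by norm_num)]
  refine (lintegral_mono_ae ?_).trans_lt hG
  filter_upwards [hfG] with ω h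
  simpa using h

theorem enorm_sq_le_of_norm_le {x : E} {K : ℝ} {g : ℝ≥0∞} (hg : g ≠ ∞)
    (h : ‖x‖ ≤ K * √g.toReal) : ‖x‖ₑ ^ 2 ≤ ENNReal.ofReal (K ^ 2) * g := by
  rw [← ofReal_norm, ← ENNReal.ofReal_pow (norm_nonneg _)]
  calc ENNReal.ofReal (‖x‖ ^ 2) ≤ ENNReal.ofReal (K ^ 2 * g.toReal) := by
        refine ENNReal.ofReal_le_ofReal ((pow_le_pow_left₀ (norm_nonneg _) h 2).trans ?_)
        rw [mul_pow, Real.sq_sqrt ENNReal.toReal_nonneg]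
    _ = ENNReal.ofReal (K ^ 2) * g := by
        rw [ENNReal.ofReal_mul (sq_nonneg _), ENNReal.ofReal_toReal hg]

theorem norm_le_sqrt_of_enorm_sq_le {x : E} {g : ℝ≥0∞} (hg : g ≠ ∞) (h : ‖x‖ₑ ^ 2 ≤ g) :
    ‖x‖ ≤ √g.toReal := by
  refine Real.le_sqrt_of_sq_le ?_
  have := ENNReal.toReal_mono hg h
  rwa [ENNReal.toReal_pow, toReal_enorm] at this

variable [NormedSpace ℝ E] [CompleteSpace E] {A : ℝ → E →L[ℝ] E} {C : ℝ}

omit [CompleteSpace E] in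
theorem aestronglyMeasurable_riemannSum {m : MeasurableSpace Ω} (Φ : ℝ → E →L[ℝ] E)
    {N : ℝ≥0 → Ω → E} {n : ℕ} {τ : ℕ → ℝ≥0}
    (hN : ∀ i ≤ n, AEStronglyMeasurable[m] (N (τ i)) P) :
    AEStronglyMeasurable[m] (fun ω => riemannSum Φ (fun t => N t ω) n τ) P := by
  choose! g hg hNg using hN
  refine ⟨fun ω => ∑ i ∈ Finset.range n, Φ (τ i) (g (i + 1) ω - g i ω),
    Finset.stronglyMeasurable_fun_sum _ fun i hi => ?_, ?_⟩
  · have hi' := Finset.mem_range.1 hi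
    exact (Φ (τ i)).continuous.comp_stronglyMeasurable ((hg (i + 1) hi').sub (hg i hi'.le))
  · have h : ∀ᵐ ω ∂P, ∀ i, i ≤ n → N (τ i) ω = g i ω :=
      ae_all_iff.2 fun i => by
        by_cases hi : i ≤ n
        · filter_upwards [hNg i hi] with ω h _ using h
        · exact Eventually.of_forall fun ω h => absurd h hi
    filter_upwards [h] with ω h
    refine Finset.sum_congr rfl fun i hi => ?_
    have hi' := Finset.mem_range.1 hi
    simp only [h i hi'.le, h (i + 1) hi']

/-- Adaptedness passes to the limit from Riemann sums, which involve `N s` for `s ≤ t` only. -/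
theorem aestronglyMeasurable_duhamel (hA : Continuous A) (hC : ∀ r, ‖A r‖ ≤ C)
    {N : ℝ≥0 → Ω → E} (hNc : ∀ᵐ ω ∂P, Continuous fun t => N t ω) (hN0 : ∀ᵐ ω ∂P, N 0 ω = 0)
    {m : MeasurableSpace Ω} {t : ℝ≥0} (hN : ∀ s ≤ t, AEStronglyMeasurable[m] (N s) P) :
    AEStronglyMeasurable[m] (fun ω => duhamel A (fun r => N r.toNNReal ω) t) P := by
  let τ : ℕ → ℕ → ℝ≥0 := fun j i => t * (i / (j + 1))
  have hτ : ∀ j, Monotone (τ j) := fun n i j hij => by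
    have : (i : ℝ≥0) ≤ j := by exact_mod_cast hij
    simp only [τ]
    gcongr
  have hτn : ∀ j, τ j (j + 1) = t := fun j => by
    have : (j : ℝ≥0) + 1 ≠ 0 := by positivity
    simp [τ, this]
  have hδ : Tendsto (fun j : ℕ => t * (1 / ((j : ℝ≥0) + 1))) atTop (𝓝 0) := by
    have : Tendsto (fun j : ℕ => 1 / ((j : ℝ≥0) + 1)) atTop (𝓝 0) :=
      tendsto_one_div_add_one
    simpa using this.const_mul t
  refine aestronglyMeasurable_of_tendsto
    (f := fun j ω => riemannSum (fun s => timeOrderedExp A t s) (fun t => N t ω) (j + 1) (τ j))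
    (fun j => aestronglyMeasurable_riemannSum _ fun i hi => hN _ (hτn j ▸ hτ j hi)) ?_
  filter_upwards [hNc, hN0] with ω h1 h2
  refine tendsto_riemannSum hA hC h1 h2 hτ (fun j => by simp [τ]) hτn hδ fun j i _ => ?_
  simp only [τ]
  push_cast
  rw [add_div, mul_add]

theorem isStochIntegral_duhamel (hA : Continuous A) (hC : ∀ r, ‖A r‖ ≤ C)
    {N : ℝ≥0 → Ω → E} (hNc : ∀ᵐ ω ∂P, Continuous fun t => N t ω) (hN0 : ∀ᵐ ω ∂P, N 0 ω = 0)
    (hN : ∀ t, AEStronglyMeasurable (N t) P) {t : ℝ≥0} {G : Ω → ℝ≥0∞} (hGm : Measurable G)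
    (hG : ∫⁻ ω, G ω ∂P < ∞) (hNG : ∀ᵐ ω ∂P, ∀ s ≤ t, ‖N s ω‖ₑ ^ 2 ≤ G ω) :
    IsStochIntegral P (fun s => timeOrderedExp A t s) N t
      (fun ω => duhamel A (fun r => N r.toNNReal ω) t) := by
  have hC0 : 0 ≤ C := (norm_nonneg _).trans (hC 0)
  have hGf : ∀ᵐ ω ∂P, G ω < ∞ := ae_lt_top hGm hG.ne
  have hI := aestronglyMeasurable_duhamel hA hC hNc hN0 (t := t) fun s _ => hN s
  have hNG' : ∀ᵐ ω ∂P, ∀ s ≤ t, ‖N s ω‖ ≤ √(G ω).toReal := by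
    filter_upwards [hGf, hNG] with ω h1 h2 s hs
    exact norm_le_sqrt_of_enorm_sq_le h1.ne (h2 s hs)
  constructor
  · set K := 1 + Real.exp (C * t) * C * t
    refine memLp_two_of_le (G := fun ω => ENNReal.ofReal (K ^ 2) * G ω) hI ?_ ?_
    · rw [lintegral_const_mul' _ _ ENNReal.ofReal_ne_top]
      exact ENNReal.mul_lt_top ENNReal.ofReal_lt_top hG
    · filter_upwards [hGf, hNG', hNc] with ω h1 h2 h3
      refine enorm_sq_le_of_norm_le h1.ne
        (norm_duhamel_le hA hC (continuous_comp_toNNReal h3) t.coe_nonneg fun r _ hr => ?_)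
      exact h2 _ (Real.toNNReal_le_iff_le_coe.2 hr)
  -- Dominated convergence is sequential: if no `δ` works, the choices `1/(j+1)` give a sequence of
  -- bad subdivisions with mesh tending to zero.
  · by_contra! hcon
    obtain ⟨ε, hε, hcon⟩ := hcon
    choose n τ hτ hτ0 hτn hτδ hlt using fun j : ℕ =>
      hcon (1 / ((j : ℝ≥0) + 1)) (by positivity)
    have hδ : Tendsto (fun j : ℕ => 1 / ((j : ℝ≥0) + 1)) atTop (𝓝 0) :=
      tendsto_one_div_add_one
    set f : ℕ → Ω → E := fun j ω =>
      riemannSum (fun s => timeOrderedExp A t s) (fun t => N t ω) (n j) (τ j)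
        - duhamel A (fun r => N r.toNNReal ω) t with hf
    -- The factor 2 bounds the oscillation of a path by twice its supremum.
    set K := Real.exp (C * t) * C * t * 2
    have hfm : ∀ j, AEStronglyMeasurable (f j) P := fun j =>
      (aestronglyMeasurable_riemannSum _ fun i _ => hN _).sub hI
    have hlim := tendsto_lintegral_of_dominated_convergence' (μ := P)
      (F := fun j ω => ‖f j ω‖ₑ ^ 2) (f := fun _ => 0)
      (fun ω => ENNReal.ofReal (K ^ 2) * G ω) (fun j => (hfm j).enorm.pow_const 2)
      (fun j => ?_) ?_ ?_
    · rw [lintegral_zero] at hlim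
      have hε2 : (0 : ℝ≥0∞) < (ε : ℝ≥0∞) ^ 2 := by
        have : (0 : ℝ≥0∞) < ε := ENNReal.coe_pos.2 hε
        positivity
      obtain ⟨j, hj⟩ := (hlim.eventually_lt_const hε2).exists
      refine absurd (hlt j) (not_lt.2 ?_)
      change eLpNorm (f j) 2 P ≤ ε
      rw [eLpNorm_eq_lintegral_rpow_enorm_toReal (by norm_num) (by norm_num)]
      have h2 : ((2 : ℝ≥0∞).toReal) = 2 := by norm_num
      rw [h2]
      have h3 : ∫⁻ ω, ‖f j ω‖ₑ ^ (2 : ℝ) ∂P ≤ (ε : ℝ≥0∞) ^ (2 : ℝ) := by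
        simpa only [ENNReal.rpow_two] using hj.le
      refine (ENNReal.rpow_le_rpow h3 (by norm_num)).trans (le_of_eq ?_)
      rw [← ENNReal.rpow_mul]
      norm_num
    · filter_upwards [hGf, hNG', hNc, hN0] with ω h1 h2 h3 h4
      refine enorm_sq_le_of_norm_le h1.ne ?_
      refine (norm_riemannSum_sub_le hA hC h3 h4 (hτ j) (hτ0 j) (hτn j)
        (η := 2 * √(G ω).toReal) fun i hi r _ hr => ?_).trans (le_of_eq (by simp only [K]; ring))
      have h5 : τ j (i + 1) ≤ t := hτn j ▸ hτ j hi
      refine (norm_sub_le _ _).trans ?_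
      linarith [h2 _ h5, h2 _ (hr.trans h5)]
    · rw [lintegral_const_mul' _ _ ENNReal.ofReal_ne_top]
      exact (ENNReal.mul_lt_top ENNReal.ofReal_lt_top hG).ne
    · filter_upwards [hNc, hN0] with ω h1 h2
      have h3 := (tendsto_riemannSum hA hC h1 h2 hτ hτ0 hτn hδ hτδ).sub_const
        (duhamel A (fun r => N r.toNNReal ω) t)
      rw [sub_self] at h3
      have h4 := ((continuous_enorm.tendsto _).comp h3)
      have h5 := (ENNReal.continuous_pow 2).continuousAt.tendsto.comp h4
      rw [enorm_zero, zero_pow two_ne_zero] at h5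
      exact h5

end Stochastic

end OUQueue

namespace OUQueue

/-! ### Measurability and continuity of sequences viewed in `L₂(w)`. -/

section ToL2

variable {w : Weight}

/-- A sequence which belongs to `L₂(w)`, as an element of that type. -/
def L2.ofMem (x : ℕ → ℝ) (h : x ∈ L2sub w) : L2 w := ⟨x, h⟩

open Classical in
/-- A sequence as an element of `L₂(w)`, with value `0` if it does not belong to that space. -/
noncomputable def toL2 (w : Weight) (x : ℕ → ℝ) : L2 w :=
  if h : x ∈ L2sub w then L2.ofMem x h else 0

theorem toL2_of_mem {x : ℕ → ℝ} (h : x ∈ L2sub w) : toL2 w x = L2.ofMem x h := dif_pos h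

theorem toL2_of_notMem {x : ℕ → ℝ} (h : x ∉ L2sub w) : toL2 w x = 0 := dif_neg h

theorem toL2_apply {x : ℕ → ℝ} (h : x ∈ L2sub w) (k : ℕ) : toL2 w x k = x k := by
  rw [toL2_of_mem h]
  rfl

theorem toL2_zero : toL2 w (fun _ => 0) = 0 := by
  by_cases h : (fun _ => 0) ∈ L2sub w
  · rw [toL2_of_mem h]
    exact L2.ext fun k => rfl
  · exact toL2_of_notMem h

theorem summable_iff_tsum_ofReal_ne_top {f : ℕ → ℝ} (hf : ∀ k, 0 ≤ f k) :
    Summable f ↔ ∑' k, ENNReal.ofReal (f k) ≠ ∞ := by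
  simp only [ENNReal.ofReal]
  rw [ENNReal.tsum_coe_ne_top_iff_summable, ← NNReal.summable_coe]
  simp only [Real.coe_toNNReal _ (hf _)]

theorem enorm_toL2_sq_le (x : ℕ → ℝ) :
    ‖toL2 w x‖ₑ ^ 2 ≤ ∑' k, ENNReal.ofReal (x (k + 1) ^ 2 / w.val (k + 1)) := by
  by_cases h : x ∈ L2sub w
  · rw [← ofReal_norm, ← ENNReal.ofReal_pow (norm_nonneg _), L2.norm_sq_eq]
    simp only [toL2_apply h]
    rw [ENNReal.ofReal_tsum_of_nonneg (fun k => div_nonneg (sq_nonneg _) (w.pos k).le) h.2]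
  · rw [toL2_of_notMem h]
    simp

theorem stronglyMeasurable_toL2 {Ω : Type*} {m : MeasurableSpace Ω} {X : ℕ → Ω → ℝ}
    (hX : ∀ k, Measurable[m] (X k)) :
    StronglyMeasurable[m] fun ω => toL2 w fun k => X k ω := by
  have hn : ∀ ω k, 0 ≤ X (k + 1) ω ^ 2 / w.val (k + 1) :=
    fun ω k => div_nonneg (sq_nonneg _) (w.pos k).le
  let S : Set Ω := {ω | (fun k => X k ω) ∈ L2sub w}
  have hS : MeasurableSet[m] S := by
    have : S = {ω | X 0 ω = 0} ∩
        {ω | ∑' k, ENNReal.ofReal (X (k + 1) ω ^ 2 / w.val (k + 1)) ≠ ∞} := by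
      ext ω
      simp only [Set.mem_inter_iff, Set.mem_ofPred_eq]
      rw [← summable_iff_tsum_ofReal_ne_top (hn ω)]
      exact Iff.rfl
    rw [this]
    have h2 : Measurable[m] fun ω => ∑' k, ENNReal.ofReal (X (k + 1) ω ^ 2 / w.val (k + 1)) :=
      Measurable.tsum fun k => (((hX _).pow_const 2).div_const _).ennreal_ofReal
    exact (hX 0 (measurableSet_singleton 0)).inter
      (h2 (measurableSet_singleton ∞)).compl
  -- The orthonormal basis of normalized coordinate sequences; partial expansions are measurable and
  -- converge in norm.
  let e : ℕ → L2 w := fun k => (L2.equivL2 w).symm (lp.single 2 k (1 : ℝ))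
  have hf : ∀ n, StronglyMeasurable[m] (S.indicator fun ω => ∑ k ∈ Finset.range n,
      (X (k + 1) ω / √(w.val (k + 1))) • e k) := fun n =>
    (Finset.stronglyMeasurable_fun_sum _ fun k _ =>
      ((hX (k + 1)).div_const _).stronglyMeasurable.smul_const _).indicator hS
  refine stronglyMeasurable_of_tendsto atTop hf (tendsto_pi_nhds.2 fun ω => ?_)
  by_cases h : ω ∈ S
  · simp only [Set.indicator_of_mem h]
    have h1 := (lp.hasSum_single (E := fun _ : ℕ => ℝ) (p := 2) (by norm_num)
      (L2.equivL2 w (toL2 w fun k => X k ω))).tendsto_sum_nat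
    have h2 := ((L2.equivL2 w).symm.continuous.tendsto _).comp h1
    rw [LinearIsometryEquiv.symm_apply_apply] at h2
    refine h2.congr fun n => ?_
    rw [Function.comp_apply, map_sum]
    refine Finset.sum_congr rfl fun k _ => ?_
    have h3 : (L2.equivL2 w (toL2 w fun k => X k ω)) k = X (k + 1) ω / √(w.val (k + 1)) := by
      change toL2 w (fun k => X k ω) (k + 1) / _ = _
      rw [toL2_apply h]
    rw [h3, ← map_smul, ← lp.single_smul, smul_eq_mul, mul_one]
  · simp only [Set.indicator_of_notMem h]
    rw [toL2_of_notMem h]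
    exact tendsto_const_nhds

/-- Coordinatewise continuity and a summable majorant on bounded time intervals give norm
continuity, by dominated convergence for series. -/
theorem continuous_toL2 {x : ℝ≥0 → ℕ → ℝ} (hx : ∀ k, Continuous fun t => x t k)
    (hx0 : ∀ t, x t 0 = 0) (hg : ∀ T : ℕ, ∃ g : ℕ → ℝ, Summable g ∧ ∀ t : ℝ≥0, t ≤ T → ∀ k,
      x t (k + 1) ^ 2 / w.val (k + 1) ≤ g k) :
    (∀ t, x t ∈ L2sub w) ∧ Continuous fun t => toL2 w (x t) := by
  have hn : ∀ (y : ℕ → ℝ) k, 0 ≤ y (k + 1) ^ 2 / w.val (k + 1) :=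
    fun y k => div_nonneg (sq_nonneg _) (w.pos k).le
  have hmem : ∀ t, x t ∈ L2sub w := fun t => by
    obtain ⟨T, hT⟩ := exists_nat_ge t
    obtain ⟨g, hgs, hgle⟩ := hg T
    exact ⟨hx0 t, Summable.of_nonneg_of_le (hn _) (hgle t hT) hgs⟩
  refine ⟨hmem, continuous_iff_continuousAt.2 fun t₀ => ?_⟩
  obtain ⟨T, hT⟩ := exists_nat_gt t₀
  obtain ⟨g, hgs, hgle⟩ := hg T
  rw [ContinuousAt, tendsto_iff_norm_sub_tendsto_zero]
  have hsq : Tendsto (fun t => ‖toL2 w (x t) - toL2 w (x t₀)‖ ^ 2) (𝓝 t₀) (𝓝 0) := by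
    have he : ∀ t, ‖toL2 w (x t) - toL2 w (x t₀)‖ ^ 2 =
        ∑' k, (x t (k + 1) - x t₀ (k + 1)) ^ 2 / w.val (k + 1) := fun t => by
      rw [L2.norm_sq_eq]
      refine tsum_congr fun k => ?_
      change (toL2 w (x t) (k + 1) - toL2 w (x t₀) (k + 1)) ^ 2 / _ = _
      rw [toL2_apply (hmem t), toL2_apply (hmem t₀)]
    simp only [he]
    rw [show (0 : ℝ) = ∑' _ : ℕ, (0 : ℝ) from tsum_zero.symm]
    refine tendsto_tsum_of_dominated_convergence (hgs.mul_left 4) (fun k => ?_) ?_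
    · have h := ((((hx (k + 1)).tendsto t₀).sub_const (x t₀ (k + 1))).pow 2).div_const
        (w.val (k + 1))
      simpa using h
    · filter_upwards [eventually_lt_nhds hT] with t ht k
      rw [Real.norm_of_nonneg (div_nonneg (sq_nonneg _) (w.pos k).le)]
      have h1 := hgle t ht.le k
      have h2 := hgle t₀ hT.le k
      have h3 : (x t (k + 1) - x t₀ (k + 1)) ^ 2 / w.val (k + 1) ≤
          2 * (x t (k + 1) ^ 2 / w.val (k + 1)) + 2 * (x t₀ (k + 1) ^ 2 / w.val (k + 1)) := by
        rw [← mul_div_assoc, ← mul_div_assoc, ← add_div]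
        refine div_le_div_of_nonneg_right ?_ (w.pos k).le
        nlinarith [sq_nonneg (x t (k + 1) + x t₀ (k + 1))]
      linarith
  have h := (Real.continuous_sqrt.tendsto 0).comp hsq
  rw [Real.sqrt_zero] at h
  exact h.congr fun t => Real.sqrt_sq (norm_nonneg _)

end ToL2

/-! ### The driving martingale as an `L₂(w)`-valued process. -/

section Driving

variable {α β : ℝ} {L : ℕ} {u : ℝ → ℕ → ℝ} {w : Weight} {Ω : Type*} {mΩ : MeasurableSpace Ω}
  {P : Measure Ω} [IsProbabilityMeasure P] {ℱ : Filtration ℝ≥0 mΩ} {M : ℕ → ℝ≥0 → Ω → ℝ}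

theorem IsDrivingMartingale.memLp (hM : IsDrivingMartingale α β L u P ℱ M) (k : ℕ) (t : ℝ≥0) :
    MemLp (M k t) 2 P := by
  rw [memLp_two_iff_integrable_sq (((hM.martingale k).stronglyMeasurable t).mono
    (ℱ.le t)).aestronglyMeasurable]
  refine (((hM.bracket k).integrable t).add (integrable_const
    (∫ s in (0 : ℝ)..t, (Fplus α L (u s) k + Fminus β (u s) k)))).congr
    (Eventually.of_forall fun ω => ?_)
  simp

theorem IsDrivingMartingale.integral_sq (hM : IsDrivingMartingale α β L u P ℱ M) (k : ℕ)
    (t : ℝ≥0) : ∫ ω, M k t ω ^ 2 ∂P =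
      ∫ s in (0 : ℝ)..t, (Fplus α L (u s) k + Fminus β (u s) k) := by
  have h := (hM.bracket k).setIntegral_eq (zero_le (a := t)) MeasurableSet.univ
  rw [setIntegral_univ, setIntegral_univ,
    integral_sub (hM.memLp k t).integrable_sq (integrable_const _),
    integral_sub (hM.memLp k 0).integrable_sq (integrable_const _)] at h
  have h0 : ∫ ω, M k 0 ω ^ 2 ∂P = 0 := by
    refine integral_eq_zero_of_ae ?_
    filter_upwards [hM.start k] with ω hω
    simp [hω]
  simp only [h0, integral_const, probReal_univ, one_smul, NNReal.coe_zero,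
    intervalIntegral.integral_same, sub_zero] at h
  linarith

/-- The bracket vanishes at `k = 0`, so each `M 0 t` is a.s. zero; a countable dense set of times
and path continuity remove the dependence on `t`. Membership in `L2sub` requires this. -/
theorem IsDrivingMartingale.zero_coord (hM : IsDrivingMartingale α β L u P ℱ M) :
    ∀ᵐ ω ∂P, ∀ t, M 0 t ω = 0 := by
  have h : ∀ t, ∀ᵐ ω ∂P, M 0 t ω = 0 := fun t => by
    have h1 := hM.integral_sq 0 t
    simp only [Fplus, Fminus, add_zero, intervalIntegral.integral_zero] at h1
    have h2 := (integral_eq_zero_iff_of_nonneg (fun ω => sq_nonneg (M 0 t ω))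
      (hM.memLp 0 t).integrable_sq).1 h1
    filter_upwards [h2] with ω hω
    simpa using hω
  have hd := ae_all_iff.2 fun n : ℕ => h (TopologicalSpace.denseSeq ℝ≥0 n)
  filter_upwards [hd, hM.continuous_paths] with ω h1 h2
  have := (h2 0).ext_on (TopologicalSpace.denseRange_denseSeq ℝ≥0)
    (continuous_const (y := (0 : ℝ))) (by rintro _ ⟨n, rfl⟩; exact h1 n)
  exact fun t => congrFun this t

/-- The driving martingale as a square-integrable process in `L₂(w)` with continuous paths. -/
theorem IsDrivingMartingale.exists_process (hM : IsDrivingMartingale α β L u P ℱ M)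
    (hs : ∀ T : ℝ≥0, Summable fun k =>
      (∫ s in (0 : ℝ)..T, (Fplus α L (u s) (k + 1) + Fminus β (u s) (k + 1))) / w.val (k + 1)) :
    ∃ N : ℝ≥0 → Ω → L2 w, (∀ᵐ ω ∂P, ∀ t k, N t ω k = M k t ω) ∧
      (∀ᵐ ω ∂P, Continuous fun t => N t ω) ∧ (∀ᵐ ω ∂P, N 0 ω = 0) ∧
      (∀ T, ∃ G : Ω → ℝ≥0∞, Measurable G ∧ ∫⁻ ω, G ω ∂P < ∞ ∧
        ∀ᵐ ω ∂P, ∀ t ≤ T, ‖N t ω‖ₑ ^ 2 ≤ G ω) ∧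
      ∀ t, ∀ m : MeasurableSpace Ω, (∀ k, Measurable[m] (M k t)) → StronglyMeasurable[m] (N t) := by
  have hc : ∀ k, ∀ᵐ ω ∂P, Continuous fun t => M k t ω := ae_all_iff.1 hM.continuous_paths
  choose G hGm hGi hG using fun (T : ℝ≥0) (k : ℕ) =>
    exists_lintegral_sup_sq_le (hM.martingale (k + 1)) (hM.memLp (k + 1)) (hc (k + 1)) T
  let r : ℕ → ℝ≥0∞ := fun k => ENNReal.ofReal (w.val (k + 1))⁻¹
  have hr : ∀ k, r k ≠ ∞ := fun k => ENNReal.ofReal_ne_top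
  -- The weighted sum of the coordinatewise Doob majorants dominates `‖N t‖²` for all `t ≤ T` at
  -- once, and its mean is at most four times the weighted sum of the brackets.
  let H : ℝ≥0 → Ω → ℝ≥0∞ := fun T ω => ∑' k, G T k ω * r k
  have hHm : ∀ T, Measurable (H T) := fun T =>
    Measurable.tsum fun k => (hGm T k).mul_const _
  have hHi : ∀ T, ∫⁻ ω, H T ω ∂P < ∞ := fun T => by
    rw [lintegral_tsum fun k => ((hGm T k).mul_const _).aemeasurable]
    have h1 : ∀ k, ∫⁻ ω, G T k ω * r k ∂P ≤ ENNReal.ofReal (4 * ((∫ s in (0 : ℝ)..T,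
        (Fplus α L (u s) (k + 1) + Fminus β (u s) (k + 1))) / w.val (k + 1))) := fun k => by
      rw [lintegral_mul_const' _ _ (hr k)]
      refine (mul_le_mul_left (hGi T k) _).trans (le_of_eq ?_)
      rw [hM.integral_sq, ← ENNReal.ofReal_mul' (inv_nonneg.2 (w.pos k).le), mul_assoc,
        ← div_eq_mul_inv]
    have h2 : ∀ k, 0 ≤ 4 * ((∫ s in (0 : ℝ)..T,
        (Fplus α L (u s) (k + 1) + Fminus β (u s) (k + 1))) / w.val (k + 1)) := fun k => by
      rw [← hM.integral_sq]
      exact mul_nonneg (by norm_num)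
        (div_nonneg (integral_nonneg fun ω => sq_nonneg _) (w.pos k).le)
    exact (ENNReal.tsum_le_tsum h1).trans_lt
      (((summable_iff_tsum_ofReal_ne_top h2).1 ((hs T).mul_left 4)).lt_top)
  have hle : ∀ T, ∀ᵐ ω ∂P, ∀ t ≤ T, ∀ k,
      ENNReal.ofReal (M (k + 1) t ω ^ 2 / w.val (k + 1)) ≤ G T k ω * r k := fun T => by
    filter_upwards [ae_all_iff.2 (hG T)] with ω h t ht k
    rw [div_eq_mul_inv, ENNReal.ofReal_mul (sq_nonneg _)]
    exact mul_le_mul_left (h k t ht) _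
  have hfin : ∀ᵐ ω ∂P, ∀ T : ℕ, H T ω < ∞ :=
    ae_all_iff.2 fun T => ae_lt_top (hHm T) (hHi T).ne
  have hpath : ∀ᵐ ω ∂P, (∀ t, (fun k => M k t ω) ∈ L2sub w) ∧
      Continuous fun t => toL2 w fun k => M k t ω := by
    filter_upwards [hM.continuous_paths, hM.zero_coord, hfin,
      ae_all_iff.2 fun T : ℕ => hle T] with ω h1 h2 h3 h4
    refine continuous_toL2 h1 h2 fun T => ⟨fun k => (G T k ω * r k).toReal,
      ENNReal.summable_toReal (h3 T).ne, fun t ht k => ?_⟩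
    exact (ENNReal.ofReal_le_iff_le_toReal (ENNReal.ne_top_of_tsum_ne_top (h3 T).ne k)).1
      (h4 T t ht k)
  -- The default value `0` defines the process at every `ω`, so it is measurable for any σ-field
  -- carrying the `M k t`: the ambient one for moments, `drivingSigma` for adaptedness.
  refine ⟨fun t ω => toL2 w fun k => M k t ω, ?_, ?_, ?_, fun T => ⟨H T, hHm T, hHi T, ?_⟩,
    fun t m hm => stronglyMeasurable_toL2 hm⟩
  · filter_upwards [hpath] with ω h t k using toL2_apply (h.1 t) k
  · filter_upwards [hpath] with ω h using h.2
  · filter_upwards [ae_all_iff.2 hM.start] with ω h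
    simp only [h]
    exact toL2_zero
  · filter_upwards [hle T] with ω h t ht
    exact (enorm_toL2_sq_le _).trans (ENNReal.tsum_le_tsum (h t ht))

end Driving

end OUQueue

namespace OUQueue

/-! ### Well-posedness of the linear equation and of the Ornstein–Uhlenbeck equation. -/

section Solutions

variable {α β : ℝ} {L : ℕ} {u : ℝ → ℕ → ℝ} {w : Weight}

theorem L2.sub_apply (x y : L2 w) (k : ℕ) : (x - y) k = x k - y k := rfl

/-- The evolution from `s` to `t` sees the generator on `[s,t]` only, so the extension to negative
times is harmless. -/
theorem timeOrderedExp_opK_eq {s t : ℝ} (hs : 0 ≤ s) (hst : s ≤ t) :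
    timeOrderedExp (fun r => opK α β L w (u r)) t s = timeOrderedExp (pathK α β L w u) t s :=
  timeOrderedExp_congr hst fun _ hr _ => (pathK_of_nonneg (hs.trans hr)).symm

theorem isLinearSolution_opK_iff {s : ℝ} (hs : 0 ≤ s) {z : ℝ → L2 w} :
    IsLinearSolution (fun r => opK α β L w (u r)) s z ↔
      IsLinearSolution (pathK α β L w u) s z :=
  forall₂_congr fun t ht => by rw [pathK_of_nonneg (hs.trans ht)]

theorem linear_wellPosed (hα : 0 < α) (hβ : 0 < β) (hL : 1 ≤ L) (hw : w.Comparable)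
    (hu : IsMeanFieldSolution α β L u) {s : ℝ} (hs : 0 ≤ s) (z₀ : L2 w) :
    IsLinearSolution (fun r => opK α β L w (u r)) s
        (fun t => timeOrderedExp (fun r => opK α β L w (u r)) t s z₀) ∧
      timeOrderedExp (fun r => opK α β L w (u r)) s s z₀ = z₀ ∧
      ∀ z : ℝ → L2 w, IsLinearSolution (fun r => opK α β L w (u r)) s z → z s = z₀ →
        ∀ t, s ≤ t → z t = timeOrderedExp (fun r => opK α β L w (u r)) t s z₀ := by
  have hA := continuous_pathK hα hβ hL hw hu
  obtain ⟨C, hC⟩ := exists_pathK_bound hα hβ hw hu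
  have h1 := isLinearSolution_timeOrderedExp hA hC s z₀
  have hself : timeOrderedExp (fun r => opK α β L w (u r)) s s z₀ = z₀ := by
    rw [timeOrderedExp_self]
    rfl
  refine ⟨(isLinearSolution_opK_iff hs).2 fun t ht => ?_, hself, fun z hz hz0 t ht => ?_⟩
  · rw [timeOrderedExp_opK_eq hs ht]
    refine (h1 t ht).congr (fun r hr => ?_) ?_
    · rw [timeOrderedExp_opK_eq hs hr]
    · rw [timeOrderedExp_opK_eq hs ht]
  · rw [timeOrderedExp_opK_eq hs ht]
    refine ((isLinearSolution_opK_iff hs).1 hz).unique (fun r _ => hC r) h1 ?_ ht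
    rw [hz0, timeOrderedExp_self]
    rfl

theorem integral_opK_eq {z : ℝ → L2 w} {t : ℝ} (ht : 0 ≤ t) :
    ∫ s in (0 : ℝ)..t, opK α β L w (u s) (z s) = ∫ s in (0 : ℝ)..t, pathK α β L w u s (z s) := by
  refine intervalIntegral.integral_congr fun s hs => ?_
  rw [Set.uIcc_of_le ht] at hs
  simp only [pathK_of_nonneg hs.1]

variable {Ω : Type*} {mΩ : MeasurableSpace Ω} {P : Measure Ω} {M : ℕ → ℝ≥0 → Ω → ℝ}

theorem IsOUSolution.indistinguishable (hα : 0 < α) (hβ : 0 < β) (hL : 1 ≤ L) (hw : w.Comparable)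
    (hu : IsMeanFieldSolution α β L u) {Z Z' : ℝ≥0 → Ω → L2 w}
    (hZ : IsOUSolution α β L w u P M Z) (hZ' : IsOUSolution α β L w u P M Z')
    (h0 : Z 0 =ᵐ[P] Z' 0) : ∀ᵐ ω ∂P, ∀ t, Z t ω = Z' t ω := by
  have hA := continuous_pathK hα hβ hL hw hu
  obtain ⟨C, hC⟩ := exists_pathK_bound hα hβ hw hu
  filter_upwards [hZ, hZ', h0] with ω ⟨i1, e1⟩ ⟨i2, e2⟩ h0
  let D : ℝ → L2 w := fun s => Z s.toNNReal ω - Z' s.toNNReal ω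
  have hD : ∀ t : ℝ, 0 ≤ t → D t = 0 := fun t ht => by
    refine eq_zero_of_eq_integral hA hC (fun s hs => ?_) (fun t ht => ?_) (fun t ht => ?_) ht
    · simp only [D, Real.toNNReal_of_nonpos hs, h0, sub_self]
    · lift t to ℝ≥0 using ht
      exact (i1 t).sub (i2 t)
    · lift t to ℝ≥0 using ht
      simp only [D, map_sub]
      rw [intervalIntegral.integral_sub (intervalIntegrable_clm_apply hA hC (i1 t))
        (intervalIntegrable_clm_apply hA hC (i2 t)), ← integral_opK_eq t.coe_nonneg,
        ← integral_opK_eq t.coe_nonneg, Real.toNNReal_coe]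
      refine L2.ext fun k => ?_
      rw [L2.sub_apply, L2.sub_apply, e1, e2, h0]
      ring
  intro t
  have := hD t t.coe_nonneg
  simp only [D, Real.toNNReal_coe] at this
  exact sub_eq_zero.1 this

theorem drivingSigma_measurable {Z₀ : Ω → L2 w} {s t : ℝ≥0} (hst : s ≤ t) (k : ℕ) :
    Measurable[drivingSigma Z₀ M t] (M k s) :=
  measurable_iff_comap_le.2 <| le_sup_of_le_right <|
    le_iSup_of_le k <| le_iSup_of_le s <| le_iSup_of_le hst le_rfl

/-- Separability of the range does not depend on the σ-field, and measurability for the smaller one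
holds by construction. -/
theorem drivingSigma_stronglyMeasurable {Z₀ : Ω → L2 w} (hZ₀ : StronglyMeasurable Z₀) (t : ℝ≥0) :
    StronglyMeasurable[drivingSigma Z₀ M t] Z₀ :=
  (stronglyMeasurable_iff_measurable_separable (m := drivingSigma Z₀ M t)).2
    ⟨measurable_iff_comap_le.2 le_sup_left, hZ₀.isSeparable_range⟩

theorem IsStochIntegral.congr {E : Type*} [NormedAddCommGroup E] [NormedSpace ℝ E]
    {Φ Ψ : ℝ → E →L[ℝ] E} {N : ℝ≥0 → Ω → E} {t : ℝ≥0} {I : Ω → E}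
    (h : IsStochIntegral P Φ N t I) (hΦ : ∀ s : ℝ≥0, s ≤ t → Ψ s = Φ s) :
    IsStochIntegral P Ψ N t I := by
  refine ⟨h.1, fun ε hε => ?_⟩
  obtain ⟨δ, hδ, H⟩ := h.2 ε hε
  refine ⟨δ, hδ, fun n τ hτ hτ0 hτn hτδ => ?_⟩
  convert H n τ hτ hτ0 hτn hτδ using 6 with ω i hi
  exact hΦ _ (hτn ▸ hτ (Finset.mem_range.1 hi).le)

variable {N : ℝ≥0 → Ω → L2 w} {Z₀ : Ω → L2 w}

/-- The pathwise solution `U(t,0) Z₀ + ∫_0^t U(t,s) dN_s`, with the stochastic integral integrated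
by parts. -/
noncomputable def mildSolution (α β : ℝ) (L : ℕ) (u : ℝ → ℕ → ℝ) (N : ℝ≥0 → Ω → L2 w)
    (Z₀ : Ω → L2 w) (t : ℝ≥0) (ω : Ω) : L2 w :=
  timeOrderedExp (pathK α β L w u) t 0 (Z₀ ω) +
    duhamel (pathK α β L w u) (fun r => N r.toNNReal ω) t

theorem isStrongOUSolution_mildSolution (hα : 0 < α) (hβ : 0 < β) (hL : 1 ≤ L)
    (hw : w.Comparable) (hu : IsMeanFieldSolution α β L u)
    (hNM : ∀ᵐ ω ∂P, ∀ t k, N t ω k = M k t ω) (hNc : ∀ᵐ ω ∂P, Continuous fun t => N t ω)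
    (hN0 : ∀ᵐ ω ∂P, N 0 ω = 0)
    (hNm : ∀ t, ∀ m : MeasurableSpace Ω, (∀ k, Measurable[m] (M k t)) → StronglyMeasurable[m] (N t))
    (hZ₀ : StronglyMeasurable Z₀) :
    IsStrongOUSolution α β L w u P M Z₀ (mildSolution α β L u N Z₀) := by
  have hA := continuous_pathK hα hβ hL hw hu
  obtain ⟨C, hC⟩ := exists_pathK_bound hα hβ hw hu
  have hstart : ∀ ω, N 0 ω = 0 → mildSolution α β L u N Z₀ 0 ω = Z₀ ω := fun ω h => by
    simp only [mildSolution, duhamel, NNReal.coe_zero, timeOrderedExp_self,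
      intervalIntegral.integral_same, Real.toNNReal_zero, h, map_zero, add_zero]
    rfl
  have hcont : ∀ᵐ ω ∂P, Continuous fun t : ℝ => timeOrderedExp (pathK α β L w u) t 0 (Z₀ ω) +
      duhamel (pathK α β L w u) (fun r => N r.toNNReal ω) t := by
    filter_upwards [hNc] with ω h
    exact continuous_mild hA hC (continuous_comp_toNNReal h) _
  have hcont' : ∀ᵐ ω ∂P, Continuous fun t => mildSolution α β L u N Z₀ t ω := by
    filter_upwards [hcont] with ω h
    exact h.comp NNReal.continuous_coe
  refine ⟨?_, fun t => ?_, hcont', ?_⟩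
  · filter_upwards [hN0] with ω h using hstart ω h
  · have h1 : AEStronglyMeasurable[drivingSigma Z₀ M t]
        (fun ω => timeOrderedExp (pathK α β L w u) t 0 (Z₀ ω)) P :=
      ⟨_, (timeOrderedExp (pathK α β L w u) t 0).continuous.comp_stronglyMeasurable
        (drivingSigma_stronglyMeasurable hZ₀ t), EventuallyEq.rfl⟩
    have h2 : AEStronglyMeasurable[drivingSigma Z₀ M t]
        (fun ω => duhamel (pathK α β L w u) (fun r => N r.toNNReal ω) t) P :=
      aestronglyMeasurable_duhamel hA hC hNc hN0 fun s hs =>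
        ⟨_, hNm s _ fun k => drivingSigma_measurable hs k, EventuallyEq.rfl⟩
    obtain ⟨g1, hg1, e1⟩ := h1
    obtain ⟨g2, hg2, e2⟩ := h2
    exact ⟨g1 + g2, hg1.add hg2, e1.add e2⟩
  · filter_upwards [hNM, hNc, hN0, hcont'] with ω h1 h2 h3 h4
    refine ⟨fun t => (continuous_comp_toNNReal h4).intervalIntegrable _ _, fun t k => ?_⟩
    have h := mild_integral_eq hA hC (continuous_comp_toNNReal h2) (Z₀ ω) t
    rw [integral_opK_eq t.coe_nonneg, hstart ω h3, ← h1 t k]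
    have he : ∫ s in (0 : ℝ)..t, pathK α β L w u s (mildSolution α β L u N Z₀ s.toNNReal ω) =
        ∫ s in (0 : ℝ)..t, pathK α β L w u s (timeOrderedExp (pathK α β L w u) s 0 (Z₀ ω) +
          duhamel (pathK α β L w u) (fun r => N r.toNNReal ω) s) := by
      refine intervalIntegral.integral_congr fun s hs => ?_
      rw [Set.uIcc_of_le t.coe_nonneg] at hs
      simp only [mildSolution, Real.coe_toNNReal s hs.1]
    rw [he]
    have h' := congrArg (fun x : L2 w => x k) h
    rw [Real.toNNReal_coe] at h'
    exact h'

theorem lintegral_iSup_mildSolution_lt_top (hα : 0 < α) (hβ : 0 < β) (hL : 1 ≤ L)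
    (hw : w.Comparable) (hu : IsMeanFieldSolution α β L u)
    (hNc : ∀ᵐ ω ∂P, Continuous fun t => N t ω) {T : ℝ≥0} {G : Ω → ℝ≥0∞} (hGm : Measurable G)
    (hG : ∫⁻ ω, G ω ∂P < ∞) (hNG : ∀ᵐ ω ∂P, ∀ s ≤ T, ‖N s ω‖ₑ ^ 2 ≤ G ω)
    (hZ₀ : ∫⁻ ω, ‖Z₀ ω‖ₑ ^ 2 ∂P < ∞) :
    ∫⁻ ω, ⨆ t ∈ Set.Iic T, ‖mildSolution α β L u N Z₀ t ω‖ₑ ^ 2 ∂P < ∞ := by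
  have hA := continuous_pathK hα hβ hL hw hu
  obtain ⟨C, hC⟩ := exists_pathK_bound hα hβ hw hu
  have hC0 := bound_nonneg hC
  set a := Real.exp (C * T)
  set b := 1 + Real.exp (C * T) * C * T
  -- From `(p + q)² ≤ 2p² + 2q²` with bounds uniform over `t ≤ T`. Monotonicity of `∫⁻` then needs
  -- no measurability of the supremum.
  have hle : ∀ᵐ ω ∂P, (⨆ t ∈ Set.Iic T, ‖mildSolution α β L u N Z₀ t ω‖ₑ ^ 2) ≤
      ENNReal.ofReal (2 * a ^ 2) * ‖Z₀ ω‖ₑ ^ 2 + ENNReal.ofReal (2 * b ^ 2) * G ω := by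
    filter_upwards [hNc, hNG, ae_lt_top hGm hG.ne] with ω h1 h2 h3
    refine iSup₂_le fun t (ht : t ≤ T) => ?_
    have htT : (t : ℝ) ≤ T := NNReal.coe_le_coe.2 ht
    have e1 : ‖timeOrderedExp (pathK α β L w u) t 0 (Z₀ ω)‖ ≤ a * ‖Z₀ ω‖ := by
      refine ContinuousLinearMap.le_of_opNorm_le _ ((norm_timeOrderedExp_le hA hC t 0).trans ?_) _
      rw [sub_zero, abs_of_nonneg t.coe_nonneg]
      exact Real.exp_le_exp.2 (mul_le_mul_of_nonneg_left htT hC0)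
    have e2 : ‖duhamel (pathK α β L w u) (fun r => N r.toNNReal ω) t‖ ≤ b * √(G ω).toReal := by
      refine (norm_duhamel_le hA hC (continuous_comp_toNNReal h1) t.coe_nonneg fun r _ hr =>
        norm_le_sqrt_of_enorm_sq_le h3.ne (h2 _ ((Real.toNNReal_le_iff_le_coe.2 hr).trans ht))).trans
        ?_
      simp only [b]
      gcongr
    have e3 : ‖mildSolution α β L u N Z₀ t ω‖ ^ 2 ≤
        2 * a ^ 2 * ‖Z₀ ω‖ ^ 2 + 2 * b ^ 2 * (G ω).toReal := by
      have h4 := pow_le_pow_left₀ (norm_nonneg _) ((norm_add_le _ _).trans (add_le_add e1 e2)) 2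
      have h5 := Real.sq_sqrt (ENNReal.toReal_nonneg (a := G ω))
      refine h4.trans ?_
      have h6 := sq_nonneg (a * ‖Z₀ ω‖ - b * √(G ω).toReal)
      calc (a * ‖Z₀ ω‖ + b * √(G ω).toReal) ^ 2
          ≤ 2 * a ^ 2 * ‖Z₀ ω‖ ^ 2 + 2 * b ^ 2 * √(G ω).toReal ^ 2 := by linarith
        _ = _ := by rw [h5]
    rw [← ofReal_norm, ← ENNReal.ofReal_pow (norm_nonneg _)]
    refine (ENNReal.ofReal_le_ofReal e3).trans (le_of_eq ?_)
    rw [ENNReal.ofReal_add (by positivity) (mul_nonneg (by positivity) ENNReal.toReal_nonneg),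
      ENNReal.ofReal_mul (p := 2 * a ^ 2) (by positivity),
      ENNReal.ofReal_mul (p := 2 * b ^ 2) (by positivity),
      ENNReal.ofReal_toReal h3.ne, ENNReal.ofReal_pow (norm_nonneg _), ofReal_norm]
  refine (lintegral_mono_ae hle).trans_lt ?_
  rw [lintegral_add_right _ (hGm.const_mul _), lintegral_const_mul' _ _ ENNReal.ofReal_ne_top,
    lintegral_const_mul' _ _ ENNReal.ofReal_ne_top]
  exact ENNReal.add_lt_top.2 ⟨ENNReal.mul_lt_top ENNReal.ofReal_lt_top hZ₀,
    ENNReal.mul_lt_top ENNReal.ofReal_lt_top hG⟩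

end Solutions

end OUQueue

/-! ### Assembly of the three assertions. -/

open OUQueue in
theorem mainTheorem2 (α β : ℝ) (hα : 0 < α) (hβ : 0 < β) (L : ℕ) (hL : 1 ≤ L)
    (w : Weight) (hw : w.Comparable) :
    -- (a) the operators `K(v)`, `v ∈ 𝒱`, are uniformly bounded on `L₂(w)`
    ((∀ v ∈ tailSet, ∀ (x : L2 w) (k : ℕ), opK α β L w v x k = linK α β L v x k) ∧
      ∃ C : ℝ, ∀ v ∈ tailSet, ‖opK α β L w v‖ ≤ C) ∧
    -- (b)
    (∀ u : ℝ → ℕ → ℝ, IsMeanFieldSolution α β L u →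
      (Summable fun k => u 0 (k + 1) ^ 2 / w.val (k + 1)) →
      -- the time-ordered exponential gives the unique solution of the linear equation
      (∀ (s : ℝ), 0 ≤ s → ∀ (z₀ : L2 w),
        IsLinearSolution (fun r => opK α β L w (u r)) s
          (fun t => timeOrderedExp (fun r => opK α β L w (u r)) t s z₀) ∧
        timeOrderedExp (fun r => opK α β L w (u r)) s s z₀ = z₀ ∧
        ∀ z : ℝ → L2 w, IsLinearSolution (fun r => opK α β L w (u r)) s z → z s = z₀ →
          ∀ t, s ≤ t → z t = timeOrderedExp (fun r => opK α β L w (u r)) t s z₀) ∧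
      -- strong uniqueness
      (∀ {Ω : Type*} {mΩ : MeasurableSpace Ω} (P : Measure Ω) [IsProbabilityMeasure P]
        (ℱ : Filtration ℝ≥0 mΩ) (M : ℕ → ℝ≥0 → Ω → ℝ),
        IsDrivingMartingale α β L u P ℱ M →
        ∀ Z Z' : ℝ≥0 → Ω → L2 w, IsOUSolution α β L w u P M Z → IsOUSolution α β L w u P M Z' →
          Z 0 =ᵐ[P] Z' 0 → ∀ᵐ ω ∂P, ∀ t, Z t ω = Z' t ω)) ∧
    -- (c)
    (∀ u : ℝ → ℕ → ℝ, IsMeanFieldSolution α β L u →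
      (Summable fun k => |u 0 (k + 1)| / w.val (k + 1)) →
      ∀ {Ω : Type*} {mΩ : MeasurableSpace Ω} (P : Measure Ω) [IsProbabilityMeasure P]
        (ℱ : Filtration ℝ≥0 mΩ) (M : ℕ → ℝ≥0 → Ω → ℝ),
        IsDrivingMartingale α β L u P ℱ M →
        ∀ Z₀ : Ω → L2 w, StronglyMeasurable Z₀ →
        -- `N` is the martingale `M` as a square-integrable process in `L₂(w)`
        ∃ N : ℝ≥0 → Ω → L2 w,
          (∀ᵐ ω ∂P, ∀ t k, N t ω k = M k t ω) ∧ (∀ t, MemLp (N t) 2 P) ∧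
        ∃ Z : ℝ≥0 → Ω → L2 w,
          -- existence and uniqueness of the strong solution
          IsStrongOUSolution α β L w u P M Z₀ Z ∧
          (∀ Z' : ℝ≥0 → Ω → L2 w, IsOUSolution α β L w u P M Z' → Z' 0 =ᵐ[P] Z₀ →
            ∀ᵐ ω ∂P, ∀ t, Z' t ω = Z t ω) ∧
          -- the variation-of-constants formula
          (∀ t : ℝ≥0, ∃ I : Ω → L2 w,
            IsStochIntegral P (fun s => timeOrderedExp (fun r => opK α β L w (u r)) t s) N t I ∧
            ∀ᵐ ω ∂P,
              Z t ω = timeOrderedExp (fun r => opK α β L w (u r)) t 0 (Z₀ ω) + I ω) ∧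
          -- the second moment bound
          ((∫⁻ ω, ‖Z₀ ω‖ₑ ^ 2 ∂P) < ∞ →
            ∀ T : ℝ≥0, (∫⁻ ω, ⨆ t ∈ Set.Iic T, ‖Z t ω‖ₑ ^ 2 ∂P) < ∞)) := by
  refine ⟨exists_opK_bound hα hβ L hw, fun u hu _ => ⟨fun s hs z₀ =>
    linear_wellPosed hα hβ hL hw hu hs z₀, fun P _ ℱ M _ Z Z' hZ hZ' h0 =>
      hZ.indistinguishable hα hβ hL hw hu hZ' h0⟩, fun u hu h0 Ω mΩ P _ ℱ M hM Z₀ hZ₀ => ?_⟩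
  have hA := continuous_pathK hα hβ hL hw hu
  obtain ⟨C, hC⟩ := exists_pathK_bound hα hβ hw hu
  obtain ⟨N, hNM, hNc, hN0, hNG, hNm⟩ := hM.exists_process (w := w)
    fun T => hu.summable_bracket hα hβ hL hw h0 T.coe_nonneg
  have hNmeas : ∀ t, AEStronglyMeasurable (N t) P := fun t =>
    (hNm t mΩ fun k => (((hM.martingale k).stronglyMeasurable t).mono
      (ℱ.le t)).measurable).aestronglyMeasurable
  have hsol := isStrongOUSolution_mildSolution hα hβ hL hw hu hNM hNc hN0 hNm hZ₀
  refine ⟨N, hNM, fun t => ?_, mildSolution α β L u N Z₀, hsol,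
    fun Z' hZ' h => hZ'.indistinguishable hα hβ hL hw hu hsol.solution (h.trans hsol.start.symm),
    fun t => ?_, fun h T => ?_⟩
  · obtain ⟨G, -, hG, hle⟩ := hNG t
    exact memLp_two_of_le (hNmeas t) hG (hle.mono fun ω h => h t le_rfl)
  · obtain ⟨G, hGm, hG, hle⟩ := hNG t
    refine ⟨_, (isStochIntegral_duhamel hA hC hNc hN0 hNmeas hGm hG hle).congr fun s hs =>
      timeOrderedExp_opK_eq s.coe_nonneg (NNReal.coe_le_coe.2 hs),
      Eventually.of_forall fun ω => ?_⟩
    rw [timeOrderedExp_opK_eq le_rfl t.coe_nonneg]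
    rfl
  · obtain ⟨G, hGm, hG, hle⟩ := hNG T
    exact lintegral_iSup_mildSolution_lt_top hα hβ hL hw hu hNc hGm hG hle h
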